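/- A monotone system of polynomials (MSP) $f=(f_1,\dots,f_n)$ consists of polynomials in $X_1,\dots,X_n$ with non-negative real coefficients. Suppose that $f$ is quadratic (all monomials have degree at most $2$), feasible (some $y\in\mathbb R_{\ge 0}^n$ satisfies $f(y)=y$) and clean (for every $i$ there is a $k$ with $f^k(0)_i>0$); $f$ need not be strongly connected. Then $f$ has a least fixed point $\mu f$ in $\mathbb R_{\ge 0}^n$. Say that $X_i$ depends directly on $X_k$ if $\partial f_i/\partial X_k$ is not the zero polynomial, and let "depends on" be the reflexive transitive closure of this relation. A strongly connected component (SCC) is a maximal non-empty set of variables each of which depends on each other one. The depth of an SCC $S$ is the length of the longest path, in the DAG of SCCs, leading from $S$ through SCCs that directly depend on the preceding one to a top SCC (one on which no other SCC depends), and $h(f)$ is the length of the longest path in this DAG. For an MSP $g$ let $\mathcal N_g(x)=x+(\mathrm{Id}-g'(x))^{-1}(g(x)-x)$, where $g'$ is the Jacobian matrix. The Decomposed Newton's Method (DNM) with parameter $j\in\mathbb N$ proceeds, for $t=h(f),h(f)-1,\dots,0$, through all SCCs $S$ of depth $t$, and sets $\nu_S:=\mathcal N_{g}^{\,j\cdot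 2^t}(0)$, where $g$ is the system of the equations of $f$ for the variables in $S$ in which the variables of the SCCs of depth greater than $t$ have been replaced by their values in $\nu$ computed before. Let $\nu^{(j)}$ be the resulting vector. Theorem. For every $j\in\mathbb N$ the DNM with parameter $j$ is well-defined (all matrices that it inverts are invertible), and there is a $k_f\in\mathbb N$ such that, for every $i\ge 0$, the vector $\nu^{(k_f+i)}$ has at least $i$ valid bits of $\mu f$, that is, $$\frac{|(\mu f)_s-\nu^{(k_f+i)}_s|}{|(\mu f)_s|}\le 2^{-i}\qquad\text{for all }1\le s\le n .$$ -/

import Mathlib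

noncomputable section

namespace MSP

/-- A system of polynomials `f = (f i)` over a finite set `σ` of variables: one real polynomial in
the variables `X k`, `k : σ`, for every `i : σ`. -/
abbrev PolySystem (σ : Type) : Type := σ → MvPolynomial σ ℝ

section Basic

variable {σ : Type}

/-- All coefficients are non-negative. -/
def IsMonotone (f : PolySystem σ) : Prop :=
  ∀ (i : σ) (m : σ →₀ ℕ), 0 ≤ (f i).coeff m

/-- All monomials have degree at most two. -/
def IsQuadratic (f : PolySystem σ) : Prop :=
  ∀ i : σ, (f i).totalDegree ≤ 2

/-- The value `f(x)` of the system at the vector `x`. -/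
def value (f : PolySystem σ) (x : σ → ℝ) : σ → ℝ :=
  fun i => MvPolynomial.eval x (f i)

/-- The non-negative fixed points of `f`. -/
def nonnegFixedPoints (f : PolySystem σ) : Set (σ → ℝ) :=
  {y | 0 ≤ y ∧ value f y = y}

/-- `f` has a non-negative fixed point. -/
def IsFeasible (f : PolySystem σ) : Prop :=
  (nonnegFixedPoints f).Nonempty

/-- The Kleene sequence `0, f(0), f(f(0)), …`. -/
def kleene (f : PolySystem σ) (k : ℕ) : σ → ℝ :=
  (value f)^[k] 0

/-- All variables are productive: each one becomes positive in the Kleene sequence. -/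
def IsClean (f : PolySystem σ) : Prop :=
  ∀ i : σ, ∃ k : ℕ, 0 < kleene f k i

/-- The least non-negative fixed point `μf`, as a componentwise infimum. -/
def lfp (f : PolySystem σ) : σ → ℝ :=
  sInf (nonnegFixedPoints f)

/-- `ν` has `i` valid bits of `μ`. -/
def HasValidBits (i : ℕ) (μ ν : σ → ℝ) : Prop :=
  ∀ s : σ, |μ s - ν s| / |μ s| ≤ (2 : ℝ) ^ (-(i : ℤ))

/-- The Jacobian matrix `f'(x)`. -/
def jacobian (f : PolySystem σ) (x : σ → ℝ) : Matrix σ σ ℝ :=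
  Matrix.of fun i k => MvPolynomial.eval x (MvPolynomial.pderiv k (f i))

/-- The matrix `Id - f'(x)` is invertible, i.e. the Newton operator of `f` is defined at `x`. -/
def NewtonDefinedAt [Fintype σ] [DecidableEq σ] (f : PolySystem σ) (x : σ → ℝ) : Prop :=
  IsUnit (1 - jacobian f x)

/-- The Newton operator `x ↦ x + (Id - f'(x))⁻¹ (f(x) - x)`. -/
def newton [Fintype σ] [DecidableEq σ] (f : PolySystem σ) (x : σ → ℝ) : σ → ℝ :=
  x + Matrix.mulVec (1 - jacobian f x)⁻¹ (value f x - x)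

/-- `X i` depends directly on `X k`: the polynomial `∂(f i)/∂(X k)` is not zero. -/
def DependsDirectly (f : PolySystem σ) (i k : σ) : Prop :=
  MvPolynomial.pderiv k (f i) ≠ 0

/-- `X i` depends on `X k`: reflexive transitive closure of direct dependence. -/
def Depends (f : PolySystem σ) : σ → σ → Prop :=
  Relation.ReflTransGen (DependsDirectly f)

/-- `S` is a strongly connected component (SCC): a maximal non-empty set of variables each of which
depends on each other one. -/
def IsSCC (f : PolySystem σ) (S : Finset σ) : Prop :=
  Maximal (fun T : Finset σ => T.Nonempty ∧ ∀ i ∈ T, ∀ k ∈ T, Depends f i k) S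

/-- The edges of the DAG of SCCs, directed upwards: from an SCC `S` to every other SCC `T` one of
whose variables depends directly on a variable of `S`. -/
def sccEdge (f : PolySystem σ) : SetRel (Finset σ) (Finset σ) :=
  {p | IsSCC f p.1 ∧ IsSCC f p.2 ∧ p.1 ≠ p.2 ∧ ∃ i ∈ p.2, ∃ k ∈ p.1, DependsDirectly f i k}

/-- A top SCC is one on which no other SCC depends. -/
def IsTopSCC (f : PolySystem σ) (S : Finset σ) : Prop :=
  IsSCC f S ∧ ∀ T, (S, T) ∉ sccEdge f

/-- The depth of an SCC `S`: the length (number of edges) of the longest path in the DAG of SCCs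
from `S` to a top SCC. -/
def depth (f : PolySystem σ) (S : Finset σ) : ℕ :=
  sSup {l : ℕ | ∃ p : RelSeries (sccEdge f), p.head = S ∧ IsTopSCC f p.last ∧ p.length = l}

/-- The set of the SCCs of depth `t`. -/
def comp (f : PolySystem σ) (t : ℕ) : Set (Finset σ) :=
  {S | IsSCC f S ∧ depth f S = t}

/-- The height of the DAG of SCCs: the length (number of edges) of its longest path. -/
def height (f : PolySystem σ) : ℕ :=
  sSup {l : ℕ | ∃ p : RelSeries (sccEdge f), IsSCC f p.head ∧ p.length = l}

open Classical in
/-- The set of the variables that depend on `X i` and on which `X i` depends. -/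
def sccOf [Fintype σ] (f : PolySystem σ) (i : σ) : Finset σ :=
  Finset.univ.filter fun k => Depends f i k ∧ Depends f k i

theorem mem_sccOf_self [Fintype σ] (f : PolySystem σ) (i : σ) : i ∈ sccOf f i := by
  simp only [sccOf, Finset.mem_filter, Finset.mem_univ, true_and]
  exact ⟨Relation.ReflTransGen.refl, Relation.ReflTransGen.refl⟩

theorem isSCC_sccOf [Fintype σ] (f : PolySystem σ) (i : σ) : IsSCC f (sccOf f i) := by
  refine ⟨⟨⟨i, mem_sccOf_self f i⟩, ?_⟩, ?_⟩
  · intro a ha b hb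
    simp only [sccOf, Finset.mem_filter, Finset.mem_univ, true_and] at ha hb
    exact Relation.ReflTransGen.trans ha.2 hb.1
  · intro T hT hle k hk
    have hi : i ∈ T := hle (mem_sccOf_self f i)
    simp only [sccOf, Finset.mem_filter, Finset.mem_univ, true_and]
    exact ⟨hT.2 i hi k hk, hT.2 k hk i hi⟩

theorem eq_sccOf_of_isSCC [Fintype σ] (f : PolySystem σ) {S : Finset σ} (hS : IsSCC f S)
    {i : σ} (hi : i ∈ S) : S = sccOf f i := by
  have hle : S ≤ sccOf f i := by
    intro k hk
    simp only [sccOf, Finset.mem_filter, Finset.mem_univ, true_and]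
    exact ⟨hS.1.2 i hi k hk, hS.1.2 k hk i hi⟩
  exact le_antisymm hle (hS.2 (isSCC_sccOf f i).1 hle)

open Classical in
/-- The system of the equations of `S`, in the variables of `S`, that results from `f` when every
variable `X k` outside `S` is replaced by the number `ν k`. -/
def subsystem (f : PolySystem σ) (S : Finset σ) (ν : σ → ℝ) : PolySystem S :=
  fun i => MvPolynomial.bind₁
    (fun k => if h : k ∈ S then MvPolynomial.X ⟨k, h⟩ else MvPolynomial.C (ν k)) (f i)

end Basic

section DNM

variable {σ : Type} [Fintype σ] [DecidableEq σ]

/-- The `k`-th Newton iterate, started at `0`, for the SCC `S` after the values `ν` have been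
substituted for the other variables. -/
def sccIterate (f : PolySystem σ) (S : Finset σ) (ν : σ → ℝ) (k : ℕ) : S → ℝ :=
  (newton (subsystem f S ν))^[k] 0

open Classical in
/-- One pass of the outer loop of the Decomposed Newton's Method, at depth `t`: for all SCCs `S`
of depth `t`, the `S`-components of `ν` are set to the result of `j * 2 ^ t` Newton iterations in
`S`. (The equations of `S` involve, apart from variables of `S`, only variables of depth greater
than `t`, so that SCCs of the same depth do not interact.) -/
def dnmPass (f : PolySystem σ) (j t : ℕ) (ν : σ → ℝ) : σ → ℝ :=
  fun i =>
    if sccOf f i ∈ comp f t then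
      sccIterate f (sccOf f i) ν (j * 2 ^ t) ⟨i, mem_sccOf_self f i⟩
    else ν i

/-- The vector `ν` after the first `m` passes, i.e. those at the depths
`height f, height f - 1, …, height f - m + 1`. Components not computed yet have the value `0`,
which is never used. -/
def dnmLoop (f : PolySystem σ) (j : ℕ) : ℕ → σ → ℝ
  | 0 => 0
  | m + 1 => dnmPass f j (height f - m) (dnmLoop f j m)

/-- The output of the Decomposed Newton's Method with parameter `j`: the passes are done for the
depths `t` from `height f` down to `0`. -/
def dnm (f : PolySystem σ) (j : ℕ) : σ → ℝ :=
  dnmLoop f j (height f + 1)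

/-- The Decomposed Newton's Method with parameter `j` is well-defined: every matrix that it has to
invert, in any of the `j * 2 ^ t` iterations in any SCC of depth `t`, is invertible. -/
def DNMWellDefined (f : PolySystem σ) (j : ℕ) : Prop :=
  ∀ t ≤ height f, ∀ S ∈ comp f t, ∀ k < j * 2 ^ t,
    NewtonDefinedAt (subsystem f S (dnmLoop f j (height f - t)))
      (sccIterate f S (dnmLoop f j (height f - t)) k)

end DNM

end MSP

end

/-! Replacing the outer variables of an SCC by values whose error is of order `ε ^ 2` moves its
fixed point by at most the order of `ε`: a critical block behaves like a double root, which loses a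
square root. Twice as many Newton steps per level of depth make up for this loss. With `ε = 2 ^ (-j
* 2 ^ t)` at depth `t`, the deeper values have error `O(ε ^ 2)` and the `j * 2 ^ t` steps in the SCC
bring its own error to `O(ε)`. Induction over the passes (`exists_dnmLoop_error_const`) leaves an
error `O(2 ^ (-j))` everywhere.

The perturbed fixed point itself is never needed. `exists_postfixed_const` gives a vector `y ≤ g y`
at distance `O(ε)` below the true solution `b`, provided that it is non-negative. By
`sub_newtonStep_le` every Newton step halves the distance to such a `y`, measured along a positive
vector `e` with `A e ≤ e`, where `A` is the block of the Jacobian at the least fixed point. Both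
arguments use that the trapezoidal rule is exact for quadratic polynomials.

The block structure enters through a dichotomy (`isRegularBlock`). A block that is linear in its own
variables is contractive, because cleanness forces a non-zero constant term. A block with a
quadratic term has a positive `d` with `A d ≤ d`, a limit of normalized Kleene errors. In the second
case `1 - A` may be singular, but the Newton iterates stay strictly below `b`, where the Jacobian is
strictly smaller than `A` somewhere. Irreducibility then makes it contractive, which gives
well-definedness. -/

open scoped Matrix

namespace MSP

/-! ### Newton's method on a single perturbed block -/

section Block

variable {ι : Type} [Fintype ι]

/-- A matrix without non-zero non-negative sub-invariant vectors; for a non-negative matrix this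
says that its spectral radius is less than one. -/
def IsContractive (M : Matrix ι ι ℝ) : Prop :=
  ∀ u : ι → ℝ, 0 ≤ u → u ≤ M *ᵥ u → u = 0

/-- The directed graph of the positive entries of the matrix is strongly connected. -/
def IsIrred (A : Matrix ι ι ℝ) : Prop :=
  ∀ Z : Set ι, Z.Nonempty → (∀ i ∈ Z, ∀ k, 0 < A i k → k ∈ Z) → ∀ i, i ∈ Z

theorem mulVec_eq_sum (M : Matrix ι ι ℝ) (u : ι → ℝ) (i : ι) :
    (M *ᵥ u) i = ∑ k, M i k * u k := rfl

theorem IsContractive.mono {M N : Matrix ι ι ℝ} (hN : IsContractive N)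
    (hMN : ∀ i k, M i k ≤ N i k) : IsContractive M := by
  intro u hu h
  refine hN u hu fun i => (h i).trans ?_
  exact Finset.sum_le_sum fun k _ => mul_le_mul_of_nonneg_right (hMN i k) (hu k)

/-- The negative part of `v` is a sub-invariant vector, hence zero. This replaces the Neumann
series: it says that `(1 - M)⁻¹` is a non-negative matrix. -/
theorem IsContractive.nonneg_of_le {M : Matrix ι ι ℝ} (hM : IsContractive M)
    (h0 : ∀ i k, 0 ≤ M i k) {v : ι → ℝ} (hv : ∀ i, ∑ k, M i k * v k ≤ v i) : ∀ i, 0 ≤ v i := by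
  have key : (fun i => max (-v i) 0) = 0 := by
    apply hM
    · exact fun i => le_max_right _ _
    · intro i
      rw [mulVec_eq_sum]
      apply max_le
      · have : -(∑ k, M i k * v k) ≤ ∑ k, M i k * max (-v k) 0 := by
          rw [← Finset.sum_neg_distrib]
          refine Finset.sum_le_sum fun k _ => ?_
          rw [← mul_neg]
          exact mul_le_mul_of_nonneg_left (le_max_left _ _) (h0 i k)
        linarith [hv i]
      · exact Finset.sum_nonneg fun k _ => mul_nonneg (h0 i k) (le_max_right _ _)
  intro i
  have := congrFun key i
  simp only [Pi.zero_apply] at this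
  have := le_max_left (-v i) 0
  linarith

/-- A kernel vector of `1 - M` and its negative are both super-invariant, so both are non-negative.
-/
theorem IsContractive.isUnit [DecidableEq ι] {M : Matrix ι ι ℝ} (hM : IsContractive M)
    (h0 : ∀ i k, 0 ≤ M i k) : IsUnit (1 - M) := by
  rw [← Matrix.mulVec_injective_iff_isUnit]
  intro v w hvw
  have h : (1 - M) *ᵥ (v - w) = 0 := by
    rw [Matrix.mulVec_sub]; exact sub_eq_zero.mpr hvw
  rw [Matrix.sub_mulVec, Matrix.one_mulVec, sub_eq_zero] at h
  have e1 : ∀ i, ∑ k, M i k * (v - w) k = (v - w) i := fun i => (congrFun h i).symm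
  have h1 := hM.nonneg_of_le h0 (v := v - w) fun i => (e1 i).le
  have h2 := hM.nonneg_of_le h0 (v := w - v) fun i => by
    have : ∑ k, M i k * (w - v) k = -∑ k, M i k * (v - w) k := by
      rw [← Finset.sum_neg_distrib]
      refine Finset.sum_congr rfl fun k _ => ?_
      simp only [Pi.sub_apply]; ring
    rw [this, e1]; simp
  funext i
  have := h1 i
  have := h2 i
  simp only [Pi.sub_apply] at *
  linarith

theorem IsContractive.exists_sub_eq_one [DecidableEq ι] {M : Matrix ι ι ℝ}
    (hM : IsContractive M) (h0 : ∀ i k, 0 ≤ M i k) :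
    ∃ p : ι → ℝ, (∀ i, 1 ≤ p i) ∧ ∀ i, p i - ∑ k, M i k * p k = 1 := by
  have hu := hM.isUnit h0
  have hdet := (Matrix.isUnit_iff_isUnit_det _).mp hu
  let p : ι → ℝ := (1 - M)⁻¹ *ᵥ 1
  have hp : (1 - M) *ᵥ p = 1 := by
    rw [Matrix.mulVec_mulVec, Matrix.mul_nonsing_inv _ hdet, Matrix.one_mulVec]
  rw [Matrix.sub_mulVec, Matrix.one_mulVec] at hp
  have hp' : ∀ i, p i - ∑ k, M i k * p k = 1 := fun i => congrFun hp i
  have hpos := hM.nonneg_of_le h0 (v := p) fun i => by linarith [hp' i]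
  refine ⟨p, fun i => ?_, hp'⟩
  have : 0 ≤ ∑ k, M i k * p k := Finset.sum_nonneg fun k _ => mul_nonneg (h0 i k) (hpos k)
  linarith [hp' i]

/-- A non-negative matrix below an irreducible one with a positive super-invariant vector is
contractive, unless it equals that matrix and the vector is invariant. -/
theorem IsIrred.isContractive {A M : Matrix ι ι ℝ} (hA : IsIrred A) (h0 : ∀ i k, 0 ≤ M i k)
    (hMA : ∀ i k, M i k ≤ A i k) {d : ι → ℝ} (hd : ∀ i, 0 < d i)
    (hAd : ∀ i, ∑ k, A i k * d k ≤ d i)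
    (hne : (∃ i k, M i k ≠ A i k) ∨ ∃ i, ∑ k, A i k * d k ≠ d i) : IsContractive M := by
  intro u hu h
  by_contra hu0
  obtain ⟨i₀, hi₀⟩ := Function.ne_iff.mp hu0
  have : Nonempty ι := ⟨i₀⟩
  obtain ⟨m, hm⟩ := Finite.exists_max fun i => u i / d i
  set θ := u m / d m with hθ
  have hle : ∀ i, u i ≤ θ * d i := fun i => (div_le_iff₀ (hd i)).mp (hm i)
  have hθ0 : 0 < θ := by
    have : 0 < u i₀ := lt_of_le_of_ne (hu i₀) (Ne.symm hi₀)
    exact (div_pos this (hd i₀)).trans_le (hm i₀)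
  -- Where the maximal ratio `θ` is attained, the chain `u ≤ M u ≤ θ A d ≤ θ d` consists of
  -- equalities. Hence the set of maximizers is closed under positive entries of `A`, and
  -- irreducibility makes it everything.
  have key : ∀ i, u i = θ * d i →
      (∀ k, M i k * u k = A i k * (θ * d k)) ∧ ∑ k, A i k * d k = d i := by
    intro i hi
    have hk : ∀ k ∈ Finset.univ, M i k * u k ≤ A i k * (θ * d k) := fun k _ =>
      mul_le_mul (hMA i k) (hle k) (hu k) ((h0 i k).trans (hMA i k))
    have h1 : u i ≤ ∑ k, M i k * u k := h i
    have h2 : ∑ k, A i k * (θ * d k) = θ * ∑ k, A i k * d k := by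
      rw [Finset.mul_sum]
      exact Finset.sum_congr rfl fun k _ => by ring
    have h3 := Finset.sum_le_sum hk
    have h4 : θ * ∑ k, A i k * d k ≤ θ * d i := mul_le_mul_of_nonneg_left (hAd i) hθ0.le
    refine ⟨fun k => ?_, ?_⟩
    · exact (Finset.sum_eq_sum_iff_of_le hk).mp (by linarith) k (Finset.mem_univ k)
    · exact mul_left_cancel₀ hθ0.ne' (by linarith)
  have hall : ∀ i, i ∈ {i | u i = θ * d i} := by
    apply hA _ ⟨m, by simp only [Set.mem_ofPred_eq, hθ]; field_simp [(hd m).ne']⟩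
    intro i hi k hik
    have h1 := (key i hi).1 k
    have h2 : M i k * u k ≤ A i k * u k := mul_le_mul_of_nonneg_right (hMA i k) (hu k)
    have h3 : A i k * (θ * d k) ≤ A i k * u k := by linarith
    exact le_antisymm (hle k) (le_of_mul_le_mul_left h3 hik)
  rcases hne with ⟨i, k, hik⟩ | ⟨i, hi⟩
  · apply hik
    have h1 := (key i (hall i)).1 k
    rw [show u k = θ * d k from hall k] at h1
    exact mul_right_cancel₀ (mul_pos hθ0 (hd k)).ne' h1
  · exact hi (key i (hall i)).2

/-- A vector function with its Jacobian, behaving like a monotone quadratic system. -/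
structure IsQuadraticPair (g : (ι → ℝ) → ι → ℝ) (G : (ι → ℝ) → Matrix ι ι ℝ) : Prop where
  nonneg : ∀ x, 0 ≤ x → ∀ i, 0 ≤ g x i
  jac_nonneg : ∀ x, 0 ≤ x → ∀ i k, 0 ≤ G x i k
  jac_mono : ∀ x y, 0 ≤ x → x ≤ y → ∀ i k, G x i k ≤ G y i k
  taylor : ∀ x y i, g y i - g x i = ∑ k, (G x i k + G y i k) / 2 * (y k - x k)

/-- The data of a strongly connected block at its least fixed point `b`: the Jacobian `A` and the
second derivative `Q`. -/
structure IsRegularBlock (A : Matrix ι ι ℝ) (Q : ι → ι → ι → ℝ) (b : ι → ℝ) : Prop where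
  pos : ∀ i, 0 < b i
  jac_nonneg : ∀ i k, 0 ≤ A i k
  hess_nonneg : ∀ i k l, 0 ≤ Q i k l
  jac_pos : ∀ i k l, 0 < Q i k l → 0 < A i k
  dichotomy : IsContractive A ∨ (IsIrred A ∧
    (∃ d : ι → ℝ, (∀ i, 0 < d i) ∧ ∀ i, ∑ k, A i k * d k ≤ d i) ∧ ∃ i k l, 0 < Q i k l)

/-- The block that results from a strongly connected block when the values outside the block are
replaced by smaller ones. -/
structure IsLowerBlock (g : (ι → ℝ) → ι → ℝ) (G : (ι → ℝ) → Matrix ι ι ℝ) (A : Matrix ι ι ℝ)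
    (Q : ι → ι → ι → ℝ) (b : ι → ℝ) : Prop extends IsQuadraticPair g G where
  jac_gap : ∀ x, 0 ≤ x → x ≤ b → ∀ i k, ∑ l, Q i k l * (b l - x l) ≤ A i k - G x i k
  gap : ∀ x, 0 ≤ x → x ≤ b → ∀ i, ∑ k, (G x i k + A i k) / 2 * (b k - x k) ≤ b i - g x i

variable {g : (ι → ℝ) → ι → ℝ} {G : (ι → ℝ) → Matrix ι ι ℝ} {A : Matrix ι ι ℝ}
  {Q : ι → ι → ι → ℝ} {b : ι → ℝ}

theorem IsQuadraticPair.mono (h : IsQuadraticPair g G) {x y : ι → ℝ} (hx : 0 ≤ x) (hxy : x ≤ y) : g x ≤ g y := by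
  intro i
  have : 0 ≤ ∑ k, (G x i k + G y i k) / 2 * (y k - x k) :=
    Finset.sum_nonneg fun k _ => mul_nonneg
      (by have := h.jac_nonneg x hx i k; have := h.jac_nonneg y (hx.trans hxy) i k; linarith)
      (sub_nonneg.mpr (hxy k))
  linarith [h.taylor x y i]

theorem IsLowerBlock.jac_le (h : IsLowerBlock g G A Q b) (hb : IsRegularBlock A Q b)
    (x : ι → ℝ) (hx : 0 ≤ x) (hxb : x ≤ b) (i k : ι) : G x i k ≤ A i k := by
  have : 0 ≤ ∑ l, Q i k l * (b l - x l) :=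
    Finset.sum_nonneg fun l _ => mul_nonneg (hb.hess_nonneg i k l) (sub_nonneg.mpr (hxb l))
  linarith [h.jac_gap x hx hxb i k]

theorem IsLowerBlock.jac_ne (h : IsLowerBlock g G A Q b) (hb : IsRegularBlock A Q b)
    {x : ι → ℝ} (hx : 0 ≤ x) (hxb : ∀ i, x i < b i) {i k l : ι} (hQ : 0 < Q i k l) :
    G x i k ≠ A i k := by
  have : 0 < ∑ l, Q i k l * (b l - x l) := Finset.sum_pos'
    (fun l _ => mul_nonneg (hb.hess_nonneg i k l) (sub_pos.mpr (hxb l)).le)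
    ⟨l, Finset.mem_univ l, mul_pos hQ (sub_pos.mpr (hxb l))⟩
  have := h.jac_gap x hx (fun i => (hxb i).le) i k
  intro h
  linarith

/-- The fixed point moves by at most the order of the square root of the perturbation: there is a
post-fixed point of the perturbed block close to `b`. -/
theorem exists_postfixed_const (hb : IsRegularBlock A Q b) {d p : ι → ℝ} (hd : ∀ i, 0 ≤ d i)
    (hAd : ∀ i, ∑ k, A i k * d k ≤ d i) (hp : ∀ i, 0 ≤ p i)
    (halt : ∀ i, 1 ≤ p i - ∑ k, A i k * p k ∨ 0 < ∑ k, ∑ l, Q i k l * d l * d k) (C : ℝ) :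
    ∃ K : ℝ, 0 < K ∧ ∀ ε : ℝ, 0 < ε → ∀ g : (ι → ℝ) → ι → ℝ,
      (∀ x, 0 ≤ x → x ≤ b → ∀ i, b i - g x i ≤ ∑ k, A i k * (b k - x k) -
        (∑ k, ∑ l, Q i k l * (b l - x l) * (b k - x k)) / 2 + C * ε ^ 2) →
      ∀ y : ι → ℝ, (∀ i, y i = b i - K * ε * (d i + ε * p i)) → 0 ≤ y → y ≤ g y := by
  let q : ι → ℝ := fun i => ∑ k, ∑ l, Q i k l * d l * d k
  let r : ι → ℝ := fun i => p i - ∑ k, A i k * p k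
  -- Inserting `y` into the expansion leaves the condition `K r + K ^ 2 q / 2 ≥ C` in every row. The
  -- first summands of `K` settle the rows with `r i ≥ 1`, the sum those with `q i > 0`; terms with
  -- `q i = 0` are zero by convention.
  let K : ℝ := 1 + |C| + ∑ i, 2 * (|r i| + |C|) / |q i|
  have hK1 : 1 + |C| ≤ K := le_add_of_nonneg_right <|
    Finset.sum_nonneg fun i _ => by positivity
  have hKq : ∀ i, 2 * (|r i| + |C|) / |q i| ≤ K := fun i => by
    have := Finset.single_le_sum (f := fun i => 2 * (|r i| + |C|) / |q i|)
      (fun i _ => by positivity) (Finset.mem_univ i)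
    have h0 := abs_nonneg C
    simp only [K]
    linarith
  have hC := le_abs_self C
  have hC0 := abs_nonneg C
  have hK0 : 0 < K := by linarith
  refine ⟨K, hK0, fun ε hε g hg y hy hy0 i => ?_⟩
  have hyb : y ≤ b := fun i => by
    have := hd i
    have := hp i
    have : 0 ≤ K * ε * (d i + ε * p i) := by positivity
    linarith [hy i]
  have hby : ∀ k, b k - y k = K * ε * (d k + ε * p k) := fun k => by linarith [hy k]
  have h1 := hg y hy0 hyb i
  simp only [hby] at h1
  have h2 : ∑ k, A i k * (K * ε * (d k + ε * p k)) =
      K * ε * ∑ k, A i k * d k + K * ε ^ 2 * ∑ k, A i k * p k := by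
    rw [Finset.mul_sum, Finset.mul_sum, ← Finset.sum_add_distrib]
    exact Finset.sum_congr rfl fun k _ => by ring
  have h3 : (K * ε) ^ 2 * q i ≤
      ∑ k, ∑ l, Q i k l * (K * ε * (d l + ε * p l)) * (K * ε * (d k + ε * p k)) := by
    simp only [q, Finset.mul_sum]
    refine Finset.sum_le_sum fun k _ => Finset.sum_le_sum fun l _ => ?_
    have e1 : d l * d k ≤ (d l + ε * p l) * (d k + ε * p k) := by
      have := hp k; have := hp l; have := hd k; have := hd l
      apply mul_le_mul
      · exact le_add_of_nonneg_right (by positivity)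
      · exact le_add_of_nonneg_right (by positivity)
      · positivity
      · positivity
    have e2 := mul_le_mul_of_nonneg_left e1
      (mul_nonneg (sq_nonneg (K * ε)) (hb.hess_nonneg i k l))
    linarith
  have h4 : K * ε * ∑ k, A i k * d k ≤ K * ε * d i :=
    mul_le_mul_of_nonneg_left (hAd i) (by positivity)
  have hr : p i - ∑ k, A i k * p k = r i := rfl
  have hq0 : 0 ≤ q i := Finset.sum_nonneg fun k _ => Finset.sum_nonneg fun l _ =>
    mul_nonneg (mul_nonneg (hb.hess_nonneg i k l) (hd l)) (hd k)
  have h5 : 0 ≤ K * r i + K ^ 2 * q i / 2 - C := by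
    rcases halt i with h | h
    · have : K * 1 ≤ K * r i := mul_le_mul_of_nonneg_left h hK0.le
      have : 0 ≤ K ^ 2 * q i / 2 := by positivity
      linarith
    · have hq : 0 < q i := h
      have e1 := hKq i
      rw [abs_of_pos hq, div_le_iff₀ hq] at e1
      have e2 : K * (2 * (|r i| + |C|)) ≤ K * (K * q i) := mul_le_mul_of_nonneg_left e1 hK0.le
      have e3 : K * (-|r i|) ≤ K * r i := mul_le_mul_of_nonneg_left (neg_abs_le _) hK0.le
      have e4 : 1 * |C| ≤ K * |C| := mul_le_mul_of_nonneg_right (by linarith) hC0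
      linarith
  have h6 := mul_nonneg (sq_nonneg ε) h5
  have h7 := hy i
  rw [h2] at h1
  have h8 : K * ε ^ 2 * ∑ k, A i k * p k = K * ε ^ 2 * (p i - r i) := by rw [← hr]; ring
  linarith

/-- In the critical case strict inequality `x < b` is essential: it lowers the Jacobian strictly at
an entry with a quadratic term, so that irreducibility applies. -/
theorem IsLowerBlock.isContractive (h : IsLowerBlock g G A Q b) (hb : IsRegularBlock A Q b)
    {x : ι → ℝ} (hx : 0 ≤ x) (hxb : x ≤ b) (halt : IsContractive A ∨ ∀ i, x i < b i) :
    IsContractive (G x) := by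
  have hle := h.jac_le hb x hx hxb
  rcases hb.dichotomy with hA | ⟨hirr, ⟨d, hd, hAd⟩, i, k, l, hQ⟩
  · exact hA.mono hle
  · rcases halt with hA | hlt
    · exact hA.mono hle
    · refine hirr.isContractive (h.jac_nonneg x hx) hle hd hAd (Or.inl ⟨i, k, ?_⟩)
      exact h.jac_ne hb hx hlt hQ

variable [DecidableEq ι]

/-- The Newton step of a vector function with given Jacobian. -/
noncomputable def newtonStep (g : (ι → ℝ) → ι → ℝ) (G : (ι → ℝ) → Matrix ι ι ℝ) (x : ι → ℝ) : ι → ℝ :=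
  x + (1 - G x)⁻¹ *ᵥ (g x - x)

theorem newtonStep_eq {x : ι → ℝ} (hu : IsUnit (1 - G x)) (i : ι) :
    newtonStep g G x i - x i - ∑ k, G x i k * (newtonStep g G x k - x k) = g x i - x i := by
  have hdet := (Matrix.isUnit_iff_isUnit_det _).mp hu
  have h : (1 - G x) *ᵥ (newtonStep g G x - x) = g x - x := by
    rw [newtonStep, add_sub_cancel_left, Matrix.mulVec_mulVec, Matrix.mul_nonsing_inv _ hdet,
      Matrix.one_mulVec]
  rw [Matrix.sub_mulVec, Matrix.one_mulVec] at h
  exact congrFun h i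

theorem IsQuadraticPair.le_newtonStep (h : IsQuadraticPair g G) {x : ι → ℝ} (hx : 0 ≤ x)
    (hxg : x ≤ g x) (hc : IsContractive (G x)) : x ≤ newtonStep g G x := by
  have := hc.nonneg_of_le (h.jac_nonneg x hx) (v := newtonStep g G x - x) fun i => by
    have h1 := newtonStep_eq (g := g) (hc.isUnit (h.jac_nonneg x hx)) i
    have h2 := hxg i
    simp only [Pi.sub_apply]
    linarith
  intro i
  have := this i
  simp only [Pi.sub_apply] at this
  linarith

theorem IsQuadraticPair.newtonStep_le (h : IsQuadraticPair g G) {x : ι → ℝ} (hx : 0 ≤ x)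
    (hxg : x ≤ g x) (hc : IsContractive (G x)) :
    newtonStep g G x ≤ g (newtonStep g G x) := by
  have hle := h.le_newtonStep hx hxg hc
  intro i
  have h1 := newtonStep_eq (g := g) (hc.isUnit (h.jac_nonneg x hx)) i
  have h2 := h.taylor x (newtonStep g G x) i
  have h3 : ∑ k, G x i k * (newtonStep g G x k - x k) ≤
      ∑ k, (G x i k + G (newtonStep g G x) i k) / 2 * (newtonStep g G x k - x k) := by
    refine Finset.sum_le_sum fun k _ => mul_le_mul_of_nonneg_right ?_ (sub_nonneg.mpr (hle k))
    linarith [h.jac_mono x _ hx hle i k]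
  linarith

/-- The lower bound `gap` for `b - g x`, minus the linear equation that defines the Newton step.
Both sums on the left are non-negative once the new iterate is known to be below `b`. -/
theorem IsLowerBlock.error_ge (h : IsLowerBlock g G A Q b) {x : ι → ℝ} (hx : 0 ≤ x) (hxb : x ≤ b)
    (hc : IsContractive (G x)) (i : ι) :
    ∑ k, G x i k * (b k - newtonStep g G x k) + ∑ k, (A i k - G x i k) / 2 * (b k - x k) ≤
      b i - newtonStep g G x i := by
  have h1 := newtonStep_eq (g := g) (hc.isUnit (h.jac_nonneg x hx)) i
  have h2 := h.gap x hx hxb i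
  have h3 : ∑ k, G x i k * (b k - newtonStep g G x k) +
      ∑ k, (A i k - G x i k) / 2 * (b k - x k) =
      ∑ k, (G x i k + A i k) / 2 * (b k - x k) -
        ∑ k, G x i k * (newtonStep g G x k - x k) := by
    rw [← Finset.sum_add_distrib, ← Finset.sum_sub_distrib]
    exact Finset.sum_congr rfl fun k _ => by ring
  linarith

theorem IsLowerBlock.newtonStep_le_bound (h : IsLowerBlock g G A Q b)
    (hb : IsRegularBlock A Q b) {x : ι → ℝ} (hx : 0 ≤ x)
    (hxb : x ≤ b) (hc : IsContractive (G x)) : newtonStep g G x ≤ b := by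
  have := hc.nonneg_of_le (h.jac_nonneg x hx) (v := b - newtonStep g G x) fun i => by
    have h1 := h.error_ge hx hxb hc i
    have h2 : 0 ≤ ∑ k, (A i k - G x i k) / 2 * (b k - x k) :=
      Finset.sum_nonneg fun k _ => mul_nonneg
        (by linarith [h.jac_le hb x hx hxb i k]) (sub_nonneg.mpr (hxb k))
    simp only [Pi.sub_apply]
    linarith
  intro i
  have := this i
  simp only [Pi.sub_apply] at this
  linarith

/-- If the step reaches `b i`, both sums in `error_ge` vanish in row `i`: the rows of `G x` and `A`
agree, and `b` is also reached at every `k` with `A i k > 0`. By irreducibility all rows agree,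
contrary to `hne`. -/
theorem IsLowerBlock.newtonStep_lt_bound (h : IsLowerBlock g G A Q b)
    (hb : IsRegularBlock A Q b) (hA : IsIrred A)
    {x : ι → ℝ} (hx : 0 ≤ x) (hxb : ∀ i, x i < b i) (hne : ∃ i k, G x i k ≠ A i k)
    (hc : IsContractive (G x)) (i : ι) : newtonStep g G x i < b i := by
  have hxb' : x ≤ b := fun i => (hxb i).le
  have hle := h.newtonStep_le_bound hb hx hxb' hc
  have key : ∀ i, newtonStep g G x i = b i →
      ∀ k, G x i k = A i k ∧ G x i k * (b k - newtonStep g G x k) = 0 := by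
    intro i hi k
    have h1 := h.error_ge hx hxb' hc i
    have n1 : ∀ k ∈ Finset.univ, 0 ≤ G x i k * (b k - newtonStep g G x k) := fun k _ =>
      mul_nonneg (h.jac_nonneg x hx i k) (sub_nonneg.mpr (hle k))
    have n2 : ∀ k ∈ Finset.univ, 0 ≤ (A i k - G x i k) / 2 * (b k - x k) := fun k _ =>
      mul_nonneg (by linarith [h.jac_le hb x hx hxb' i k]) (sub_nonneg.mpr (hxb' k))
    have s1 := Finset.sum_nonneg n1
    have s2 := Finset.sum_nonneg n2
    rw [hi, sub_self] at h1
    have z1 := (Finset.sum_eq_zero_iff_of_nonneg n1).mp (by linarith) k (Finset.mem_univ k)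
    have z2 := (Finset.sum_eq_zero_iff_of_nonneg n2).mp (by linarith) k (Finset.mem_univ k)
    refine ⟨?_, z1⟩
    rcases mul_eq_zero.mp z2 with h | h
    · linarith
    · linarith [hxb k]
  by_contra hcon
  have hi : newtonStep g G x i = b i := le_antisymm (hle i) (not_lt.mp hcon)
  have hall : ∀ i, i ∈ {i | newtonStep g G x i = b i} := by
    apply hA _ ⟨i, hi⟩
    intro i hi k hik
    obtain ⟨e1, e2⟩ := key i hi k
    rw [e1] at e2
    rcases mul_eq_zero.mp e2 with h | h
    · linarith
    · simp only [Set.mem_ofPred_eq]; linarith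
  obtain ⟨i, k, hik⟩ := hne
  exact hik (key i (hall i) k).1

/-- One Newton step halves the distance to a post-fixed point, measured along a cone vector. -/
theorem IsLowerBlock.sub_newtonStep_le (h : IsLowerBlock g G A Q b)
    (hb : IsRegularBlock A Q b) {d : ι → ℝ}
    (hd : ∀ i, 0 ≤ d i) (hAd : ∀ i, ∑ k, A i k * d k ≤ d i) {x y : ι → ℝ} (hx : 0 ≤ x)
    (hxg : x ≤ g x) (hxb : x ≤ b) (hyg : y ≤ g y) (hy : 0 ≤ y) (hyb : y ≤ b)
    (hc : IsContractive (G x)) {c : ℝ} (hc0 : 0 ≤ c) (hyx : ∀ i, y i - x i ≤ c * d i) (i : ι) :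
    y i - newtonStep g G x i ≤ c / 2 * d i := by
  set w : ι → ℝ := x ⊔ y with hw
  have hxw : x ≤ w := le_sup_left
  have hwb : w ≤ b := sup_le hxb hyb
  have hw0 : 0 ≤ w := hx.trans hxw
  have hwg : w ≤ g w := sup_le (hxg.trans (h.mono hx hxw)) (hyg.trans (h.mono hy le_sup_right))
  have hwx : ∀ i, w i - x i ≤ c * d i := fun i => by
    have : w i = max (x i) (y i) := rfl
    have h0 := mul_nonneg hc0 (hd i)
    rcases max_choice (x i) (y i) with h | h <;> rw [this, h] <;> linarith [hyx i]
  -- The trapezoidal rule bounds `(1 - G x)(w - newtonStep g G x)` by `(G w - G x)(w - x) / 2`,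
  -- which is at most `c / 2 * (A - G x) d ≤ c / 2 * (1 - G x) d`. Applying the non-negative inverse
  -- of `1 - G x` gives the halving.
  have := hc.nonneg_of_le (h.jac_nonneg x hx)
    (v := fun i => c / 2 * d i - (w i - newtonStep g G x i)) fun i => by
    have h1 := newtonStep_eq (g := g) (hc.isUnit (h.jac_nonneg x hx)) i
    have h2 := h.taylor x w i
    have h3 : ∑ k, (G w i k - G x i k) / 2 * (w k - x k) ≤
        ∑ k, (A i k - G x i k) / 2 * (c * d k) := by
      refine Finset.sum_le_sum fun k _ => mul_le_mul ?_ (hwx k) (sub_nonneg.mpr (hxw k)) ?_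
      · linarith [h.jac_le hb w hw0 hwb i k]
      · linarith [h.jac_le hb x hx hxb i k]
    have h4 : ∑ k, (A i k - G x i k) / 2 * (c * d k) =
        c / 2 * ∑ k, A i k * d k - c / 2 * ∑ k, G x i k * d k := by
      rw [Finset.mul_sum, Finset.mul_sum, ← Finset.sum_sub_distrib]
      exact Finset.sum_congr rfl fun k _ => by ring
    have h5 : ∑ k, (G x i k + G w i k) / 2 * (w k - x k) =
        ∑ k, (G w i k - G x i k) / 2 * (w k - x k) + ∑ k, G x i k * (w k - x k) := by
      rw [← Finset.sum_add_distrib]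
      exact Finset.sum_congr rfl fun k _ => by ring
    have h6 : ∑ k, G x i k * (c / 2 * d k - (w k - newtonStep g G x k)) =
        c / 2 * ∑ k, G x i k * d k - ∑ k, G x i k * (w k - x k) +
          ∑ k, G x i k * (newtonStep g G x k - x k) := by
      rw [Finset.mul_sum, ← Finset.sum_sub_distrib, ← Finset.sum_add_distrib]
      exact Finset.sum_congr rfl fun k _ => by ring
    have h7 : c / 2 * ∑ k, A i k * d k ≤ c / 2 * d i :=
      mul_le_mul_of_nonneg_left (hAd i) (by linarith)
    have h8 := hwg i
    linarith
  have h1 := this i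
  have h2 : y i ≤ w i := le_sup_right (a := x) i
  linarith

/-- The last conjunct, strictness unless `A` is contractive, is what keeps the next matrix
invertible. -/
theorem IsLowerBlock.newton_iterate (h : IsLowerBlock g G A Q b) (hb : IsRegularBlock A Q b)
    (m : ℕ) : 0 ≤ (newtonStep g G)^[m] 0 ∧ (newtonStep g G)^[m] 0 ≤ b ∧
      (newtonStep g G)^[m] 0 ≤ g ((newtonStep g G)^[m] 0) ∧
      (IsContractive A ∨ ∀ i, (newtonStep g G)^[m] 0 i < b i) := by
  induction m with
  | zero => exact ⟨le_rfl, fun i => (hb.pos i).le, h.nonneg 0 le_rfl, Or.inr hb.pos⟩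
  | succ m ih =>
    rw [Function.iterate_succ_apply']
    obtain ⟨h0, hle, hg, halt⟩ := ih
    set x := (newtonStep g G)^[m] 0
    have hc := h.isContractive hb h0 hle halt
    refine ⟨h0.trans (h.le_newtonStep h0 hg hc), h.newtonStep_le_bound hb h0 hle hc,
      h.newtonStep_le h0 hg hc, ?_⟩
    rcases hb.dichotomy with hA | ⟨hirr, -, i, k, l, hQ⟩
    · exact Or.inl hA
    · rcases halt with hA | hlt
      · exact Or.inl hA
      · exact Or.inr (h.newtonStep_lt_bound hb hirr h0 hlt ⟨i, k, h.jac_ne hb h0 hlt hQ⟩ hc)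

theorem IsLowerBlock.isUnit_newton_iterate (h : IsLowerBlock g G A Q b)
    (hb : IsRegularBlock A Q b) (m : ℕ) : IsUnit (1 - G ((newtonStep g G)^[m] 0)) := by
  obtain ⟨h0, hle, -, halt⟩ := h.newton_iterate hb m
  exact (h.isContractive hb h0 hle halt).isUnit (h.jac_nonneg _ h0)

theorem IsLowerBlock.sub_newton_iterate_le (h : IsLowerBlock g G A Q b)
    (hb : IsRegularBlock A Q b) {d : ι → ℝ} (hd : ∀ i, 0 ≤ d i)
    (hAd : ∀ i, ∑ k, A i k * d k ≤ d i) {y : ι → ℝ} (hyg : y ≤ g y) (hy : 0 ≤ y) (hyb : y ≤ b)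
    {c : ℝ} (hc : 0 ≤ c) (hyd : ∀ i, y i ≤ c * d i) (m : ℕ) (i : ι) :
    y i - (newtonStep g G)^[m] 0 i ≤ c / 2 ^ m * d i := by
  induction m generalizing i with
  | zero => simpa using hyd i
  | succ m ih =>
    rw [Function.iterate_succ_apply']
    obtain ⟨h0, hle, hg, halt⟩ := h.newton_iterate hb m
    have := h.sub_newtonStep_le hb hd hAd h0 hg hle hyg hy hyb
      (h.isContractive hb h0 hle halt) (by positivity) ih i
    rwa [div_div, ← pow_succ] at this

/-- Directions along which post-fixed points of perturbed blocks approach the fixed point. -/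
theorem IsRegularBlock.exists_directions (hb : IsRegularBlock A Q b) :
    ∃ e d p : ι → ℝ, ((∀ i, 0 < e i) ∧ ∀ i, ∑ k, A i k * e k ≤ e i) ∧
      ((∀ i, 0 ≤ d i) ∧ ∀ i, ∑ k, A i k * d k ≤ d i) ∧ (∀ i, 0 ≤ p i) ∧
      ∀ i, 1 ≤ p i - ∑ k, A i k * p k ∨ 0 < ∑ k, ∑ l, Q i k l * d l * d k := by
  classical
  rcases hb.dichotomy with hA | ⟨hirr, ⟨d, hd, hAd⟩, i, k, l, hQ⟩
  -- With `d = 0` the post-fixed point lies at distance `O(ε ^ 2)`: no square root is lost.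
  · obtain ⟨p, hp1, hp⟩ := hA.exists_sub_eq_one hb.jac_nonneg
    refine ⟨p, 0, p, ⟨fun i => by linarith [hp1 i], fun i => by linarith [hp i]⟩,
      ⟨fun i => le_rfl, fun i => by simp⟩, fun i => by linarith [hp1 i],
      fun i => Or.inl (hp i).ge⟩
  -- Rows with a quadratic term gain from `Q d d > 0` and need no correction by `p`. Clearing them
  -- makes the matrix contractive, and its `p` serves the remaining rows.
  · let M : Matrix ι ι ℝ := Matrix.of fun i k => if ∃ k l, 0 < Q i k l then 0 else A i k
    have hM : ∀ i k, M i k = if ∃ k l, 0 < Q i k l then 0 else A i k := fun i k => rfl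
    have hM0 : ∀ i k, 0 ≤ M i k := fun i k => by
      rw [hM]; split_ifs
      · exact le_rfl
      · exact hb.jac_nonneg i k
    have hMA : ∀ i k, M i k ≤ A i k := fun i k => by
      rw [hM]; split_ifs
      · exact hb.jac_nonneg i k
      · exact le_rfl
    have hc : IsContractive M := hirr.isContractive hM0 hMA hd hAd <| Or.inl ⟨i, k, by
      rw [hM, if_pos ⟨k, l, hQ⟩]; exact (hb.jac_pos i k l hQ).ne⟩
    obtain ⟨p, hp1, hp⟩ := hc.exists_sub_eq_one hM0
    refine ⟨d, d, p, ⟨hd, hAd⟩, ⟨fun i => (hd i).le, hAd⟩, fun i => by linarith [hp1 i],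
      fun i => ?_⟩
    by_cases hi : ∃ k l, 0 < Q i k l
    · right
      obtain ⟨k, l, hkl⟩ := hi
      have n2 : ∀ k l, 0 ≤ Q i k l * d l * d k := fun k l =>
        mul_nonneg (mul_nonneg (hb.hess_nonneg i k l) (hd l).le) (hd k).le
      refine Finset.sum_pos' (fun k _ => Finset.sum_nonneg fun l _ => n2 k l)
        ⟨k, Finset.mem_univ k, Finset.sum_pos' (fun l _ => n2 k l) ⟨l, Finset.mem_univ l, ?_⟩⟩
      exact mul_pos (mul_pos hkl (hd l)) (hd k)
    · left
      have : ∑ k, A i k * p k = ∑ k, M i k * p k :=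
        Finset.sum_congr rfl fun k _ => by rw [hM, if_neg hi]
      rw [this, hp i]

/-- The error splits into `b - y = O(ε)` and the distance from `y` to the iterate, which is `O(2 ^
(-m))` along `e`. The constant depends on the block at `b` and on `C` only, uniformly in the
perturbation. -/
theorem IsRegularBlock.exists_error_const (hb : IsRegularBlock A Q b) (C : ℝ) :
    ∃ C' : ℝ, 0 ≤ C' ∧ ∀ ε : ℝ, 0 < ε → ε ≤ 1 → ∀ (g : (ι → ℝ) → ι → ℝ)
      (G : (ι → ℝ) → Matrix ι ι ℝ), IsLowerBlock g G A Q b →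
      (∀ x, 0 ≤ x → x ≤ b → ∀ i, b i - g x i ≤ ∑ k, A i k * (b k - x k) -
        (∑ k, ∑ l, Q i k l * (b l - x l) * (b k - x k)) / 2 + C * ε ^ 2) →
      ∀ m : ℕ, 1 / 2 ^ m ≤ ε → ∀ i, b i - (newtonStep g G)^[m] 0 i ≤ C' * ε := by
  obtain ⟨e, d, p, ⟨he, hAe⟩, ⟨hd, hAd⟩, hp, halt⟩ := hb.exists_directions
  obtain ⟨K, hK, hpost⟩ := exists_postfixed_const hb hd hAd hp halt C
  let c : ℝ := ∑ i, b i / e i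
  have hc0 : ∀ i ∈ Finset.univ, 0 ≤ b i / e i := fun i _ => (div_pos (hb.pos i) (he i)).le
  have hc : 0 ≤ c := Finset.sum_nonneg hc0
  have hbc : ∀ i, b i ≤ c * e i := fun i =>
    (div_le_iff₀ (he i)).mp (Finset.single_le_sum hc0 (Finset.mem_univ i))
  let s : ι → ℝ := fun i => K * (d i + p i)
  have hs : ∀ i, 0 ≤ s i := fun i => mul_nonneg hK.le (add_nonneg (hd i) (hp i))
  have hn1 : ∀ i ∈ Finset.univ, 0 ≤ s i + c * e i := fun i _ =>
    add_nonneg (hs i) (mul_nonneg hc (he i).le)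
  have hn2 : ∀ i ∈ Finset.univ, 0 ≤ b i := fun i _ => (hb.pos i).le
  have hn3 : ∀ i ∈ Finset.univ, 0 ≤ s i / b i := fun i _ => div_nonneg (hs i) (hb.pos i).le
  have hp2 : 0 ≤ (∑ i, b i) * ∑ i, s i / b i :=
    mul_nonneg (Finset.sum_nonneg hn2) (Finset.sum_nonneg hn3)
  refine ⟨∑ i, (s i + c * e i) + (∑ i, b i) * ∑ i, s i / b i,
    add_nonneg (Finset.sum_nonneg hn1) hp2, fun ε hε hε1 g G hgG hg m hm i => ?_⟩
  have hds : ∀ i, K * ε * (d i + ε * p i) ≤ ε * s i := fun i => by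
    have : ε * p i ≤ 1 * p i := mul_le_mul_of_nonneg_right hε1 (hp i)
    have : K * ε * (d i + ε * p i) ≤ K * ε * (d i + p i) :=
      mul_le_mul_of_nonneg_left (by linarith) (by positivity)
    simp only [s]
    linarith
  rw [add_mul]
  have hs1 := Finset.single_le_sum hn1 (Finset.mem_univ i)
  by_cases hy0 : ∀ i, 0 ≤ b i - K * ε * (d i + ε * p i)
  · have hyg := hpost ε hε g hg (fun i => b i - K * ε * (d i + ε * p i)) (fun _ => rfl) hy0
    have hyb : (fun i => b i - K * ε * (d i + ε * p i)) ≤ b := fun i => by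
      have := hd i
      have := hp i
      have : 0 ≤ K * ε * (d i + ε * p i) := by positivity
      simp only
      linarith
    have h1 := hgG.sub_newton_iterate_le hb (fun i => (he i).le) hAe hyg hy0 hyb hc
      (fun i => (hyb i).trans (hbc i)) m i
    have h2 : c / 2 ^ m * e i ≤ ε * (c * e i) := by
      have := mul_le_mul_of_nonneg_right hm (mul_nonneg hc (he i).le)
      calc c / 2 ^ m * e i = 1 / 2 ^ m * (c * e i) := by ring
        _ ≤ _ := this
    have h3 : ε * (s i + c * e i) ≤ ε * ∑ i, (s i + c * e i) :=
      mul_le_mul_of_nonneg_left hs1 hε.le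
    have h4 := mul_nonneg hp2 hε.le
    linarith [hds i]
  -- If `y` has a negative entry, then `ε` is bounded below by a constant of the block, and the
  -- trivial bound `b i ≤ ∑ i, b i` suffices.
  · push Not at hy0
    obtain ⟨k, hk⟩ := hy0
    have h1 : 1 ≤ ε * (s k / b k) := by
      rw [← mul_div_assoc, le_div_iff₀ (hb.pos k)]
      linarith [hds k]
    have h2 : s k / b k ≤ ∑ i, s i / b i := Finset.single_le_sum hn3 (Finset.mem_univ k)
    have h3 : b i ≤ ∑ i, b i := Finset.single_le_sum hn2 (Finset.mem_univ i)
    have h4 := mul_le_mul_of_nonneg_left h2 hε.le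
    have h5 : (∑ i, b i) * 1 ≤ (∑ i, b i) * (ε * ∑ i, s i / b i) :=
      mul_le_mul_of_nonneg_left (h1.trans h4) (Finset.sum_nonneg hn2)
    have h6 : 0 ≤ (∑ i, (s i + c * e i)) * ε := mul_nonneg (Finset.sum_nonneg hn1) hε.le
    have h7 := (hgG.newton_iterate hb m).1 i
    simp only [Pi.zero_apply] at h7
    linarith

end Block

/-! ### Quadratic expansions of monotone systems and of their subsystems -/

section Quadratic

variable {σ : Type}

/-- The gradient of `p` is `x ↦ L + Q x` with non-negative `L` and `Q`, and `p` satisfies the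
trapezoidal rule. -/
structure HasQuadraticExpansion [Fintype σ] (p : MvPolynomial σ ℝ) (L : σ → ℝ) (Q : σ → σ → ℝ) :
    Prop where
  lin_nonneg : ∀ k, 0 ≤ L k
  quad_nonneg : ∀ k l, 0 ≤ Q k l
  pderiv_eq : ∀ x k, MvPolynomial.eval x (MvPolynomial.pderiv k p) = L k + ∑ l, Q k l * x l
  trapezoid : ∀ x y, MvPolynomial.eval y p - MvPolynomial.eval x p =
    ∑ k, (MvPolynomial.eval x (MvPolynomial.pderiv k p) +
      MvPolynomial.eval y (MvPolynomial.pderiv k p)) / 2 * (y k - x k)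

theorem HasQuadraticExpansion.add [Fintype σ] {p p' : MvPolynomial σ ℝ} {L L' : σ → ℝ}
    {Q Q' : σ → σ → ℝ} (h : HasQuadraticExpansion p L Q) (h' : HasQuadraticExpansion p' L' Q') :
    HasQuadraticExpansion (p + p') (L + L') (Q + Q') where
  lin_nonneg k := add_nonneg (h.lin_nonneg k) (h'.lin_nonneg k)
  quad_nonneg k l := add_nonneg (h.quad_nonneg k l) (h'.quad_nonneg k l)
  pderiv_eq x k := by
    simp only [map_add, h.pderiv_eq, h'.pderiv_eq, Pi.add_apply, add_mul, Finset.sum_add_distrib]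
    ring
  trapezoid x y := by
    have e := h.trapezoid x y
    have e' := h'.trapezoid x y
    simp only [map_add]
    rw [add_sub_add_comm, e, e', ← Finset.sum_add_distrib]
    exact Finset.sum_congr rfl fun k _ => by ring

theorem exists_single_add {m : σ →₀ ℕ} {d : ℕ} (hm : m.degree ≤ d + 1) (h0 : m ≠ 0) :
    ∃ a m', m = Finsupp.single a 1 + m' ∧ m'.degree ≤ d := by
  classical
  obtain ⟨a, ha⟩ := Finsupp.ne_iff.mp h0
  have hle : Finsupp.single a 1 ≤ m := by
    rw [Finsupp.single_le_iff]
    exact Nat.one_le_iff_ne_zero.mpr ha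
  refine ⟨a, m - Finsupp.single a 1, (add_tsub_cancel_of_le hle).symm, ?_⟩
  have h := congrArg Finsupp.degree (add_tsub_cancel_of_le hle)
  rw [map_add, Finsupp.degree_single] at h
  omega

theorem exists_quadraticExpansion_monomial [Fintype σ] {m : σ →₀ ℕ} (hm : m.degree ≤ 2) {c : ℝ}
    (hc : 0 ≤ c) : ∃ L Q, HasQuadraticExpansion (MvPolynomial.monomial m c) L Q := by
  classical
  by_cases h0 : m = 0
  · subst h0
    exact ⟨0, 0, by simp, by simp, by simp, by simp⟩
  obtain ⟨a, m, rfl, hm'⟩ := exists_single_add (d := 1) hm h0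
  clear h0
  by_cases h0 : m = 0
  · subst h0
    have hX : MvPolynomial.monomial (Finsupp.single a 1 + 0) c =
        MvPolynomial.C c * MvPolynomial.X a := by
      rw [add_zero, MvPolynomial.C_mul_X_eq_monomial]
    have hD : ∀ x k, MvPolynomial.eval x
        (MvPolynomial.pderiv k (MvPolynomial.C c * MvPolynomial.X a)) = if k = a then c else 0 := by
      intro x k
      rw [MvPolynomial.pderiv_C_mul, MvPolynomial.pderiv_X]
      by_cases h : k = a
      · subst h; simp
      · simp [h, Ne.symm h]
    refine ⟨fun k => if k = a then c else 0, 0, fun k => ?_, by simp, ?_, ?_⟩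
    · split_ifs <;> simp [hc]
    · intro x k; rw [hX, hD]; simp
    · intro x y
      rw [hX]
      simp only [hD]
      simp only [MvPolynomial.eval_mul, MvPolynomial.eval_C, MvPolynomial.eval_X]
      rw [Finset.sum_eq_single a (fun k _ hk => by simp [hk]) (by simp)]
      simp only [if_true]; ring
  obtain ⟨b, m, rfl, hm''⟩ := exists_single_add (d := 0) hm' h0
  have hm0 : m = 0 := (Finsupp.degree_eq_zero_iff m).mp (Nat.le_zero.mp hm'')
  subst hm0
  have hX : MvPolynomial.monomial (Finsupp.single a 1 + (Finsupp.single b 1 + 0)) c =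
      MvPolynomial.C c * (MvPolynomial.X a * MvPolynomial.X b) := by
    rw [add_zero, MvPolynomial.X, MvPolynomial.X, MvPolynomial.monomial_mul,
      MvPolynomial.C_mul_monomial]
    simp
  have hD : ∀ x k, MvPolynomial.eval x
      (MvPolynomial.pderiv k (MvPolynomial.C c * (MvPolynomial.X a * MvPolynomial.X b))) =
        c * (if k = a then x b else 0) + c * (if k = b then x a else 0) := by
    intro x k
    rw [MvPolynomial.pderiv_C_mul, MvPolynomial.pderiv_mul, MvPolynomial.pderiv_X,
      MvPolynomial.pderiv_X]
    by_cases ha : k = a <;> by_cases hb : k = b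
    · subst ha; subst hb; simp; ring
    · subst ha; simp [Ne.symm hb, hb]
    · subst hb; simp [Ne.symm ha, ha]
    · simp [ha, hb, Ne.symm ha, Ne.symm hb]
  refine ⟨0, fun k l => c * (if k = a then if l = b then 1 else 0 else 0) +
    c * (if k = b then if l = a then 1 else 0 else 0), by simp, fun k l => ?_, ?_, ?_⟩
  · split_ifs <;> simp [hc]
  · intro x k
    rw [hX, hD]
    simp only [add_mul, Finset.sum_add_distrib, mul_assoc, ← Finset.mul_sum]
    by_cases ha : k = a <;> by_cases hb : k = b <;> simp [ha, hb]
  · intro x y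
    rw [hX]
    simp only [hD]
    simp only [MvPolynomial.eval_mul, MvPolynomial.eval_C, MvPolynomial.eval_X]
    have : ∀ k, (c * (if k = a then x b else 0) + c * (if k = b then x a else 0) +
        (c * (if k = a then y b else 0) + c * (if k = b then y a else 0))) / 2 * (y k - x k) =
        (if k = a then c * (x b + y b) / 2 * (y a - x a) else 0) +
        (if k = b then c * (x a + y a) / 2 * (y b - x b) else 0) := by
      intro k
      by_cases ha : k = a <;> by_cases hb : k = b
      · subst ha; subst hb; simp only [if_true]; ring
      · subst ha; simp only [if_true, if_neg hb]; ring
      · subst hb; simp only [if_true, if_neg ha]; ring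
      · simp only [if_neg ha, if_neg hb]; ring
    simp only [this, Finset.sum_add_distrib, Finset.sum_ite_eq', Finset.mem_univ, if_true]
    ring

theorem exists_quadraticExpansion [Fintype σ] {p : MvPolynomial σ ℝ} (h0 : ∀ m, 0 ≤ p.coeff m)
    (hdeg : p.totalDegree ≤ 2) : ∃ L Q, HasQuadraticExpansion p L Q := by
  have key : ∀ s : Finset (σ →₀ ℕ), (∀ m ∈ s, m.degree ≤ 2) →
      ∃ L Q, HasQuadraticExpansion (∑ m ∈ s, MvPolynomial.monomial m (p.coeff m)) L Q := by
    classical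
    intro s
    induction s using Finset.induction_on with
    | empty => exact fun _ => ⟨0, 0, by simp, by simp, by simp, by simp⟩
    | insert m s hm ih =>
      intro hs
      obtain ⟨L, Q, h⟩ := ih fun m hm => hs m (Finset.mem_insert_of_mem hm)
      obtain ⟨L', Q', h'⟩ :=
        exists_quadraticExpansion_monomial (hs m (Finset.mem_insert_self m s)) (h0 m)
      rw [Finset.sum_insert hm]
      exact ⟨_, _, h'.add h⟩
  have := key p.support fun m hm => (MvPolynomial.le_totalDegree hm).trans hdeg
  rwa [← MvPolynomial.as_sum] at this

/-- The Jacobian of `f` is `x ↦ L + Q x` with non-negative `L` and `Q`, and `f` satisfies the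
trapezoidal rule. -/
structure HasJacobianExpansion [Fintype σ] (f : PolySystem σ) (L : σ → σ → ℝ)
    (Q : σ → σ → σ → ℝ) : Prop where
  lin_nonneg : ∀ i k, 0 ≤ L i k
  quad_nonneg : ∀ i k l, 0 ≤ Q i k l
  jac_eq : ∀ x i k, jacobian f x i k = L i k + ∑ l, Q i k l * x l
  trapezoid : ∀ x y i, value f y i - value f x i =
    ∑ k, (jacobian f x i k + jacobian f y i k) / 2 * (y k - x k)

theorem exists_jacobianExpansion [Fintype σ] {f : PolySystem σ} (hm : IsMonotone f)
    (hq : IsQuadratic f) : ∃ L Q, HasJacobianExpansion f L Q := by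
  choose L Q h using fun i => exists_quadraticExpansion (hm i) (hq i)
  exact ⟨L, Q, fun i => (h i).lin_nonneg, fun i => (h i).quad_nonneg,
    fun x i k => (h i).pderiv_eq x k, fun x y i => (h i).trapezoid x y⟩

theorem eval_nonneg {p : MvPolynomial σ ℝ} (h0 : ∀ m, 0 ≤ p.coeff m) {x : σ → ℝ} (hx : 0 ≤ x) :
    0 ≤ MvPolynomial.eval x p := by
  rw [MvPolynomial.eval_eq]
  exact Finset.sum_nonneg fun m _ => mul_nonneg (h0 m) (Finset.prod_nonneg fun i _ =>
    pow_nonneg (hx i) _)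

theorem eval_pos {p : MvPolynomial σ ℝ} (h0 : ∀ m, 0 ≤ p.coeff m) (hp : p ≠ 0) {x : σ → ℝ}
    (hx : ∀ i, 0 < x i) : 0 < MvPolynomial.eval x p := by
  rw [MvPolynomial.eval_eq]
  obtain ⟨m, hm⟩ := MvPolynomial.support_nonempty.mpr hp
  refine Finset.sum_pos' (fun m _ => mul_nonneg (h0 m) (Finset.prod_nonneg fun i _ =>
    pow_nonneg (hx i).le _)) ⟨m, hm, ?_⟩
  exact mul_pos ((h0 m).lt_of_ne' (MvPolynomial.mem_support_iff.mp hm))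
    (Finset.prod_pos fun i _ => pow_pos (hx i) _)

theorem coeff_pderiv_nonneg {p : MvPolynomial σ ℝ} (h0 : ∀ m, 0 ≤ p.coeff m) (k : σ)
    (m : σ →₀ ℕ) : 0 ≤ (MvPolynomial.pderiv k p).coeff m := by
  classical
  rw [MvPolynomial.coeff_pderiv]
  exact mul_nonneg (h0 _) (by positivity)

theorem dependsDirectly_iff {f : PolySystem σ} (hm : IsMonotone f) {x : σ → ℝ}
    (hx : ∀ i, 0 < x i) (i k : σ) : DependsDirectly f i k ↔ 0 < jacobian f x i k := by
  constructor
  · exact fun h => eval_pos (coeff_pderiv_nonneg (hm i) k) h hx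
  · intro h h0
    have : jacobian f x i k = 0 := by simp [jacobian, h0]
    exact h.ne' this

variable [Fintype σ] {f : PolySystem σ} {L : σ → σ → ℝ} {Q : σ → σ → σ → ℝ}

theorem HasJacobianExpansion.isQuadraticPair (h : HasJacobianExpansion f L Q)
    (hm : IsMonotone f) : IsQuadraticPair (value f) (jacobian f) where
  nonneg _ hx i := eval_nonneg (hm i) hx
  jac_nonneg x hx i k := by
    rw [h.jac_eq]
    exact add_nonneg (h.lin_nonneg i k)
      (Finset.sum_nonneg fun l _ => mul_nonneg (h.quad_nonneg i k l) (hx l))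
  jac_mono x y _ hxy i k := by
    rw [h.jac_eq, h.jac_eq]
    gcongr with l
    · exact h.quad_nonneg i k l
    · exact hxy l
  taylor := h.trapezoid

/-- The vector that is `x` on `S` and `ν` elsewhere. -/
noncomputable def glue (S : Finset σ) (x : S → ℝ) (ν : σ → ℝ) : σ → ℝ :=
  open Classical in fun k => if h : k ∈ S then x ⟨k, h⟩ else ν k

omit [Fintype σ] in
theorem glue_coe (S : Finset σ) (x : S → ℝ) (ν : σ → ℝ) (k : S) : glue S x ν k = x k := by
  simp [glue]

omit [Fintype σ] in
theorem glue_of_notMem {S : Finset σ} (x : S → ℝ) (ν : σ → ℝ) {k : σ} (h : k ∉ S) :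
    glue S x ν k = ν k := by
  simp [glue, h]

omit [Fintype σ] in
theorem glue_le_glue {S : Finset σ} {x y : S → ℝ} {ν ξ : σ → ℝ} (hxy : x ≤ y) (hν : ν ≤ ξ) :
    glue S x ν ≤ glue S y ξ := by
  intro k
  by_cases h : k ∈ S
  · simpa [glue, h] using hxy ⟨k, h⟩
  · simpa [glue, h] using hν k

omit [Fintype σ] in
theorem glue_nonneg {S : Finset σ} {x : S → ℝ} {ν : σ → ℝ} (hx : 0 ≤ x) (hν : 0 ≤ ν) :
    0 ≤ glue S x ν := by
  intro k
  by_cases h : k ∈ S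
  · simpa [glue, h] using hx ⟨k, h⟩
  · simpa [glue, h] using hν k

omit [Fintype σ] in
theorem glue_le {S : Finset σ} {x : S → ℝ} {μ ν : σ → ℝ} (hx : x ≤ fun k : S => μ k)
    (hν : ν ≤ μ) : glue S x ν ≤ μ := by
  intro k
  by_cases h : k ∈ S
  · simpa [glue, h] using hx ⟨k, h⟩
  · simpa [glue, h] using hν k

omit [Fintype σ] in
theorem eval_bind₁_subst (S : Finset σ) (ν : σ → ℝ) (x : S → ℝ) (p : MvPolynomial σ ℝ) :
    open Classical in
    MvPolynomial.eval x (MvPolynomial.bind₁ (fun k => if h : k ∈ S then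
      (MvPolynomial.X ⟨k, h⟩ : MvPolynomial S ℝ) else MvPolynomial.C (ν k)) p) =
      MvPolynomial.eval (glue S x ν) p := by
  classical
  induction p using MvPolynomial.induction_on with
  | C a => simp
  | add p q hp hq => simp only [map_add, hp, hq]
  | mul_X p k hp =>
    simp only [map_mul, hp, MvPolynomial.bind₁_X_right, MvPolynomial.eval_X]
    by_cases h : k ∈ S <;> simp [glue, h]

omit [Fintype σ] in
theorem pderiv_bind₁_subst (S : Finset σ) (ν : σ → ℝ) (k : S) (p : MvPolynomial σ ℝ) :
    open Classical in
    MvPolynomial.pderiv k (MvPolynomial.bind₁ (fun k => if h : k ∈ S then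
      (MvPolynomial.X ⟨k, h⟩ : MvPolynomial S ℝ) else MvPolynomial.C (ν k)) p) =
    MvPolynomial.bind₁ (fun k => if h : k ∈ S then
      (MvPolynomial.X ⟨k, h⟩ : MvPolynomial S ℝ) else MvPolynomial.C (ν k))
      (MvPolynomial.pderiv (k : σ) p) := by
  classical
  induction p using MvPolynomial.induction_on with
  | C a => simp
  | add p q hp hq => simp only [map_add, hp, hq]
  | mul_X p l hp =>
    simp only [map_mul, map_add, MvPolynomial.pderiv_mul, hp, MvPolynomial.bind₁_X_right,
      MvPolynomial.pderiv_X]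
    by_cases h : l ∈ S
    · by_cases hkl : (k : σ) = l
      · subst hkl; simp
      · have : k ≠ ⟨l, h⟩ := fun e => hkl (congrArg Subtype.val e)
        simp [h, Ne.symm hkl, Ne.symm this]
    · have : (k : σ) ≠ l := fun e => h (e ▸ k.2)
      simp [h, Ne.symm this]

omit [Fintype σ] in
theorem value_subsystem (f : PolySystem σ) (S : Finset σ) (ν : σ → ℝ) (x : S → ℝ) (i : S) :
    value (subsystem f S ν) x i = value f (glue S x ν) i :=
  eval_bind₁_subst S ν x (f i)

omit [Fintype σ] in
theorem jacobian_subsystem (f : PolySystem σ) (S : Finset σ) (ν : σ → ℝ) (x : S → ℝ) (i k : S) :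
    jacobian (subsystem f S ν) x i k = jacobian f (glue S x ν) i k := by
  simp only [jacobian, Matrix.of_apply, subsystem]
  rw [pderiv_bind₁_subst, eval_bind₁_subst]

theorem sum_eq_sum_coe_add (S : Finset σ) [DecidableEq σ] (F : σ → ℝ) :
    ∑ k, F k = ∑ k : S, F k + ∑ k ∈ Sᶜ, F k := by
  rw [Finset.sum_coe_sort, Finset.sum_add_sum_compl]

variable [DecidableEq σ] {S : Finset σ} {μ ν : σ → ℝ}

/-- All properties are inherited from `f` at the glued vectors. In `taylor` the outer terms cancel;
in `jac_gap` and `gap` they are non-negative since `ν ≤ μ`, and are dropped. -/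
theorem HasJacobianExpansion.isLowerBlock_subsystem (h : HasJacobianExpansion f L Q)
    (hm : IsMonotone f) (hμ : value f μ = μ) (hν : 0 ≤ ν) (hνμ : ν ≤ μ) :
    IsLowerBlock (value (subsystem f S ν)) (jacobian (subsystem f S ν))
      (Matrix.of fun i k : S => jacobian f μ i k) (fun i k l : S => Q i k l)
      (fun i : S => μ i) := by
  have hp := h.isQuadraticPair hm
  have hglue : ∀ x : S → ℝ, 0 ≤ x → 0 ≤ glue S x ν := fun x hx =>
    glue_nonneg hx hν
  have hglue' : ∀ x : S → ℝ, (x ≤ fun k : S => μ k) → glue S x ν ≤ μ := fun x hx =>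
    glue_le hx hνμ
  refine ⟨⟨?_, ?_, ?_, ?_⟩, ?_, ?_⟩
  · intro x hx i
    rw [value_subsystem]
    exact hp.nonneg _ (hglue x hx) i
  · intro x hx i k
    rw [jacobian_subsystem]
    exact hp.jac_nonneg _ (hglue x hx) i k
  · intro x y hx hxy i k
    rw [jacobian_subsystem, jacobian_subsystem]
    exact hp.jac_mono _ _ (hglue x hx) (glue_le_glue hxy le_rfl) i k
  · intro x y i
    simp only [value_subsystem, jacobian_subsystem]
    rw [h.trapezoid, sum_eq_sum_coe_add S, Finset.sum_eq_zero (s := Sᶜ), add_zero]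
    · simp only [glue_coe]
    · intro k hk
      rw [glue_of_notMem _ _ (Finset.mem_compl.mp hk), glue_of_notMem _ _ (Finset.mem_compl.mp hk),
        sub_self, mul_zero]
  · intro x hx hxb i k
    rw [jacobian_subsystem, Matrix.of_apply, h.jac_eq, h.jac_eq, add_sub_add_left_eq_sub,
      ← Finset.sum_sub_distrib, sum_eq_sum_coe_add S]
    have : 0 ≤ ∑ l ∈ Sᶜ, (Q i k l * μ l - Q i k l * glue S x ν l) :=
      Finset.sum_nonneg fun l _ => by
        rw [← mul_sub]
        exact mul_nonneg (h.quad_nonneg _ _ _) (sub_nonneg.mpr (hglue' x hxb l))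
    simp only [glue_coe, ← mul_sub] at this ⊢
    linarith
  · intro x hx hxb i
    have h1 := h.trapezoid (glue S x ν) μ i
    rw [hμ, sum_eq_sum_coe_add S] at h1
    have : 0 ≤ ∑ k ∈ Sᶜ, (jacobian f (glue S x ν) i k + jacobian f μ i k) / 2 *
        (μ k - glue S x ν k) := Finset.sum_nonneg fun k _ => by
      have := hp.jac_nonneg _ (hglue x hx) i k
      have := hp.jac_nonneg _ (hν.trans hνμ) i k
      exact mul_nonneg (by linarith) (sub_nonneg.mpr (hglue' x hxb k))
    simp only [value_subsystem, jacobian_subsystem, Matrix.of_apply, glue_coe] at this h1 ⊢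
    linarith

/-- The second-order expansion at `μ`, with the influence of the outer error collected in `δ`. This
is the form in which `exists_error_const` takes the perturbation. -/
theorem HasJacobianExpansion.sub_value_subsystem_le (h : HasJacobianExpansion f L Q)
    (hm : IsMonotone f) (hμ : value f μ = μ) (hν : 0 ≤ ν) (hνμ : ν ≤ μ) {δ : ℝ} (i : S)
    (hδ : ∑ k ∈ Sᶜ, jacobian f μ i k * (μ k - ν k) ≤ δ)
    (x : S → ℝ) (hx : 0 ≤ x) (hxb : x ≤ fun i : S => μ i) :
    μ i - value (subsystem f S ν) x i ≤ ∑ k : S, jacobian f μ i k * (μ k - x k) -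
      (∑ k : S, ∑ l : S, Q i k l * (μ l - x l) * (μ k - x k)) / 2 + δ := by
  have hp := h.isQuadraticPair hm
  have hlb := h.isLowerBlock_subsystem (S := S) hm hμ hν hνμ
  have h1 := h.trapezoid (glue S x ν) μ i
  rw [hμ, sum_eq_sum_coe_add S] at h1
  have hz : 0 ≤ glue S x ν := glue_nonneg hx hν
  have hzμ : glue S x ν ≤ μ := glue_le hxb hνμ
  have h2 : ∑ k ∈ Sᶜ, (jacobian f (glue S x ν) i k + jacobian f μ i k) / 2 *
        (μ k - glue S x ν k) ≤ ∑ k ∈ Sᶜ, jacobian f μ i k * (μ k - ν k) := by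
    refine Finset.sum_le_sum fun k hk => ?_
    rw [glue_of_notMem _ _ (Finset.mem_compl.mp hk)]
    refine mul_le_mul_of_nonneg_right ?_ (sub_nonneg.mpr (hνμ k))
    linarith [hp.jac_mono _ _ hz hzμ i k]
  have h3 : ∑ k : S, (jacobian f (glue S x ν) i k + jacobian f μ i k) / 2 *
      (μ k - glue S x ν k) ≤ ∑ k : S, jacobian f μ i k * (μ k - x k) -
      (∑ k : S, ∑ l : S, Q i k l * (μ l - x l) * (μ k - x k)) / 2 := by
    rw [Finset.sum_div, ← Finset.sum_sub_distrib]
    refine Finset.sum_le_sum fun k _ => ?_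
    have h4 := mul_le_mul_of_nonneg_right (hlb.jac_gap x hx hxb i k) (sub_nonneg.mpr (hxb k))
    rw [jacobian_subsystem, Matrix.of_apply] at h4
    rw [glue_coe, ← Finset.sum_mul]
    linarith
  rw [value_subsystem]
  linarith

end Quadratic

/-! ### The Kleene sequence and the least fixed point -/

section Kleene

open Filter Topology

variable {σ : Type} [Fintype σ] {f : PolySystem σ}

omit [Fintype σ] in
theorem kleene_succ (f : PolySystem σ) (m : ℕ) : kleene f (m + 1) = value f (kleene f m) :=
  Function.iterate_succ_apply' _ _ _

theorem kleene_nonneg (hp : IsQuadraticPair (value f) (jacobian f)) (m : ℕ) :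
    0 ≤ kleene f m := by
  induction m with
  | zero => exact le_rfl
  | succ m ih => rw [kleene_succ]; exact hp.nonneg _ ih

theorem kleene_le_succ (hp : IsQuadraticPair (value f) (jacobian f)) (m : ℕ) :
    kleene f m ≤ kleene f (m + 1) := by
  induction m with
  | zero => exact kleene_nonneg hp 1
  | succ m ih =>
    rw [kleene_succ, kleene_succ f (m + 1)]
    exact hp.mono (kleene_nonneg hp m) ih

theorem kleene_le (hp : IsQuadraticPair (value f) (jacobian f)) {y : σ → ℝ}
    (hy : y ∈ nonnegFixedPoints f) (m : ℕ) : kleene f m ≤ y := by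
  induction m with
  | zero => exact hy.1
  | succ m ih =>
    rw [kleene_succ, ← hy.2]
    exact hp.mono (kleene_nonneg hp m) ih

omit [Fintype σ] in
theorem continuous_value (f : PolySystem σ) : Continuous (value f) :=
  continuous_pi fun i => MvPolynomial.continuous_eval (f i)

omit [Fintype σ] in
theorem continuous_jacobian (f : PolySystem σ) (i k : σ) :
    Continuous fun x => jacobian f x i k :=
  MvPolynomial.continuous_eval (MvPolynomial.pderiv k (f i))

theorem exists_tendsto_kleene (hp : IsQuadraticPair (value f) (jacobian f))
    (hf : IsFeasible f) :
    ∃ μ, Tendsto (kleene f) atTop (𝓝 μ) ∧ IsLeast (nonnegFixedPoints f) μ := by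
  obtain ⟨y, hy⟩ := hf
  have hmono : Monotone (kleene f) := monotone_nat_of_le_succ (kleene_le_succ hp)
  have hlim : Tendsto (kleene f) atTop (𝓝 fun i => ⨆ m, kleene f m i) := by
    rw [tendsto_pi_nhds]
    intro i
    exact tendsto_atTop_ciSup (fun m l h => hmono h i)
      ⟨y i, by rintro _ ⟨m, rfl⟩; exact kleene_le hp hy m i⟩
  refine ⟨_, hlim, ⟨ge_of_tendsto' hlim (kleene_nonneg hp), ?_⟩,
    fun z hz => le_of_tendsto' hlim (kleene_le hp hz)⟩
  have h1 := ((continuous_value f).tendsto _).comp hlim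
  have h2 := hlim.comp (tendsto_add_atTop_nat 1)
  refine tendsto_nhds_unique h1 (h2.congr fun m => ?_)
  exact kleene_succ f m

theorem isLeast_lfp (hp : IsQuadraticPair (value f) (jacobian f)) (hf : IsFeasible f) :
    IsLeast (nonnegFixedPoints f) (lfp f) := by
  obtain ⟨μ, -, hμ⟩ := exists_tendsto_kleene hp hf
  rwa [lfp, hμ.csInf_eq]

theorem tendsto_kleene (hp : IsQuadraticPair (value f) (jacobian f)) (hf : IsFeasible f) :
    Tendsto (kleene f) atTop (𝓝 (lfp f)) := by
  obtain ⟨μ, h, hμ⟩ := exists_tendsto_kleene hp hf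
  rwa [lfp, hμ.csInf_eq]

theorem lfp_pos (hp : IsQuadraticPair (value f) (jacobian f)) (hf : IsFeasible f)
    (hc : IsClean f) (i : σ) : 0 < lfp f i := by
  obtain ⟨m, hm⟩ := hc i
  exact hm.trans_le (kleene_le hp (isLeast_lfp hp hf).1 m i)

end Kleene

/-! ### The Jacobian block of an SCC at the least fixed point -/

section Component

open Filter Topology

variable {σ : Type} [Fintype σ] {f : PolySystem σ} {S : Finset σ}

theorem IsSCC.mem_of_depends (hS : IsSCC f S) {i k v : σ} (hi : i ∈ S) (hk : k ∈ S)
    (h1 : Depends f i v) (h2 : Depends f v k) : v ∈ S := by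
  rw [eq_sccOf_of_isSCC f hS hi]
  simp only [sccOf, Finset.mem_filter, Finset.mem_univ, true_and]
  exact ⟨h1, h2.trans (hS.1.2 k hk i hi)⟩

/-- The block of the Jacobian that belongs to an SCC is irreducible. -/
theorem IsSCC.isIrred (hS : IsSCC f S) (hm : IsMonotone f) {x : σ → ℝ} (hx : ∀ i, 0 < x i) :
    IsIrred (Matrix.of fun i k : S => jacobian f x i k) := by
  rintro Z ⟨i, hi⟩ hZ k
  have key : ∀ v, Depends f v k → ∀ hv : v ∈ S, (⟨v, hv⟩ : S) ∈ Z → k ∈ Z := by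
    intro v hvk
    induction hvk using Relation.ReflTransGen.head_induction_on with
    | refl => exact fun _ h => h
    | head hvw hwk ih =>
      intro hv hvZ
      have hw := hS.mem_of_depends hv k.2 (Relation.ReflTransGen.single hvw) hwk
      exact ih hw (hZ _ hvZ ⟨_, hw⟩ ((dependsDirectly_iff hm hx _ _).mp hvw))
  exact key i (hS.1.2 i i.2 k k.2) i.2 hi

variable {L : σ → σ → ℝ} {Q : σ → σ → σ → ℝ}

/-- An SCC without quadratic monomials has a contractive Jacobian. -/
theorem HasJacobianExpansion.isContractive_of_linear [DecidableEq σ]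
    (h : HasJacobianExpansion f L Q)
    (hm : IsMonotone f) (hf : IsFeasible f) (hc : IsClean f) (hS : IsSCC f S)
    (hQ : ∀ i k l : S, Q i k l = 0) :
    IsContractive (Matrix.of fun i k : S => jacobian f (lfp f) i k) := by
  have hp := h.isQuadraticPair hm
  have hμ := (isLeast_lfp hp hf).1
  have hpos := lfp_pos hp hf hc
  set z := glue S 0 (lfp f) with hz
  have hz0 : 0 ≤ z := glue_nonneg le_rfl hμ.1
  have hzμ : z ≤ lfp f := glue_le (fun i => hμ.1 i) le_rfl
  -- Without quadratic terms inside `S`, the block does not depend on the coordinates in `S`. So on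
  -- `S` the fixed point equation is affine, with constant term `value f z`.
  have hjac : ∀ i k : S, jacobian f z i k = jacobian f (lfp f) i k := fun i k => by
    rw [h.jac_eq, h.jac_eq]
    congr 1
    refine Finset.sum_congr rfl fun l _ => ?_
    by_cases hl : l ∈ S
    · rw [hQ i k ⟨l, hl⟩]; simp
    · rw [hz, glue_of_notMem _ _ hl]
  have htaylor : ∀ i : S, lfp f i - value f z i = ∑ k : S, jacobian f (lfp f) i k * lfp f k := by
    intro i
    have h1 := h.trapezoid z (lfp f) i
    rw [hμ.2, sum_eq_sum_coe_add S, Finset.sum_eq_zero (s := Sᶜ), add_zero] at h1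
    · rw [h1]
      refine Finset.sum_congr rfl fun k _ => ?_
      rw [hjac, hz, glue_coe, Pi.zero_apply]
      ring
    · intro k hk
      rw [hz, glue_of_notMem _ _ (Finset.mem_compl.mp hk), sub_self, mul_zero]
  have hz1 := fun i => hp.nonneg z hz0 i
  refine (hS.isIrred hm hpos).isContractive (d := fun i => lfp f i)
    (fun i k => hp.jac_nonneg _ hμ.1 i k) (fun _ _ => le_rfl) (fun i => hpos i)
    (fun i => ?_) (Or.inr ?_)
  · have := hz1 i
    have := htaylor i
    simp only [Matrix.of_apply]
    linarith
  · by_contra hcon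
    push Not at hcon
    have hzero : ∀ i : S, value f z i = 0 := fun i => by
      have h1 := htaylor i
      have h2 := hcon i
      simp only [Matrix.of_apply] at h2
      linarith
    -- With zero constant term the Kleene sequence would stay zero on `S`, contradicting cleanness.
    have hk : ∀ m, ∀ i : S, kleene f m i = 0 := by
      intro m
      induction m with
      | zero => exact fun _ => rfl
      | succ m ih =>
        intro i
        have hle : kleene f m ≤ z := by
          intro k
          by_cases hk : k ∈ S
          · have h1 := ih ⟨k, hk⟩
            simp only at h1
            rw [h1]; exact hz0 k
          · rw [hz, glue_of_notMem _ _ hk]; exact kleene_le hp hμ m k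
        refine le_antisymm ?_ (kleene_nonneg hp _ _)
        rw [kleene_succ, ← hzero i]
        exact hp.mono (kleene_nonneg hp m) hle i
    obtain ⟨i, hi⟩ := hS.1.1
    obtain ⟨m, hm⟩ := hc i
    have := hk m ⟨i, hi⟩
    simp only at this
    linarith

/-- A limit of the normalized errors of the Kleene sequence is a cone vector. -/
theorem HasJacobianExpansion.exists_cone_vector [DecidableEq σ]
    (h : HasJacobianExpansion f L Q) (hm : IsMonotone f) (hf : IsFeasible f) (hc : IsClean f)
    (hS : IsSCC f S) (hQ : ∃ i k l : S, 0 < Q i k l) :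
    ∃ d : S → ℝ, (∀ i, 0 < d i) ∧ ∀ i : S, ∑ k : S, jacobian f (lfp f) i k * d k ≤ d i := by
  have hp := h.isQuadraticPair hm
  have hμ := (isLeast_lfp hp hf).1
  have hpos := lfp_pos hp hf hc
  have hirr := hS.isIrred hm hpos
  have hlim := tendsto_kleene hp hf
  have hJQ : ∀ i k l, Q i k l * lfp f l ≤ jacobian f (lfp f) i k := fun i k l => by
    rw [h.jac_eq]
    have := Finset.single_le_sum (f := fun l => Q i k l * lfp f l)
      (fun l _ => mul_nonneg (h.quad_nonneg i k l) (hμ.1 l)) (Finset.mem_univ l)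
    linarith [h.lin_nonneg i k]
  have hstep : ∀ m, ∀ i : S, ∑ k : S, (jacobian f (kleene f m) i k + jacobian f (lfp f) i k) / 2 *
      (lfp f k - kleene f m k) ≤ lfp f i - kleene f (m + 1) i := by
    intro m i
    have h1 := h.trapezoid (kleene f m) (lfp f) i
    rw [hμ.2, ← kleene_succ, sum_eq_sum_coe_add S] at h1
    have : 0 ≤ ∑ k ∈ Sᶜ, (jacobian f (kleene f m) i k + jacobian f (lfp f) i k) / 2 *
        (lfp f k - kleene f m k) := Finset.sum_nonneg fun k _ => by
      have := hp.jac_nonneg _ (kleene_nonneg hp m) i k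
      have := hp.jac_nonneg _ hμ.1 i k
      exact mul_nonneg (by linarith) (sub_nonneg.mpr (kleene_le hp hμ m k))
    linarith
  -- The Kleene error never vanishes on all of `S`, so it can be normalized. Otherwise a column `j`
  -- of the block would be zero; as the quadratic term gives a non-zero entry in another column, the
  -- complement of `j` would be a non-empty closed set, against irreducibility.
  have hlt : ∀ m, ∃ i : S, kleene f m i < lfp f i := by
    intro m
    induction m with
    | zero =>
      obtain ⟨i, hi⟩ := hS.1.1
      exact ⟨⟨i, hi⟩, hpos i⟩
    | succ m ih =>
      obtain ⟨j, hj⟩ := ih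
      by_contra hcon
      push Not at hcon
      have hcol : ∀ i : S, jacobian f (lfp f) i j = 0 := by
        intro i
        have n : ∀ k ∈ (Finset.univ : Finset S), 0 ≤ (jacobian f (kleene f m) i k +
            jacobian f (lfp f) i k) / 2 * (lfp f k - kleene f m k) := fun k _ => by
          have := hp.jac_nonneg _ (kleene_nonneg hp m) i k
          have := hp.jac_nonneg _ hμ.1 i k
          exact mul_nonneg (by linarith) (sub_nonneg.mpr (kleene_le hp hμ m k))
        have h1 := hstep m i
        have h2 := hcon i
        have h3 := Finset.sum_nonneg n
        have h4 := (Finset.sum_eq_zero_iff_of_nonneg n).mp (by linarith) j (Finset.mem_univ j)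
        have := hp.jac_nonneg _ (kleene_nonneg hp m) i j
        have := hp.jac_nonneg _ hμ.1 i j
        rcases mul_eq_zero.mp h4 with h | h <;> linarith
      obtain ⟨i, k, l, hikl⟩ := hQ
      have hik : 0 < jacobian f (lfp f) i k := (mul_pos hikl (hpos l)).trans_le (hJQ i k l)
      have hkj : k ≠ j := by
        rintro rfl
        exact hik.ne' (hcol i)
      refine hirr {v | v ≠ j} ⟨k, hkj⟩ ?_ j rfl
      rintro v - w hvw rfl
      exact hvw.ne' (hcol v)
  let s : ℕ → ℝ := fun m => ∑ k : S, (lfp f k - kleene f m k)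
  have hdnn : ∀ m k, 0 ≤ lfp f k - kleene f m k := fun m k =>
    sub_nonneg.mpr (kleene_le hp hμ m k)
  have hs : ∀ m, 0 < s m := fun m => by
    obtain ⟨i, hi⟩ := hlt m
    exact Finset.sum_pos' (fun k _ => hdnn m k) ⟨i, Finset.mem_univ i, sub_pos.mpr hi⟩
  -- The normalized errors lie in the compact standard simplex. Each satisfies `f'(kleene f m)`
  -- times the error at most the error, since the errors decrease; this passes to the limit.
  obtain ⟨d, hd, φ, hφ, hdlim⟩ := (isCompact_stdSimplex ℝ S).tendsto_subseq
    (x := fun m (k : S) => (lfp f k - kleene f m k) / s m) fun m =>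
      ⟨fun k => div_nonneg (hdnn m k) (hs m).le, by
        rw [← Finset.sum_div]; exact div_self (hs m).ne'⟩
  have hle : ∀ i : S, ∑ k : S, jacobian f (lfp f) i k * d k ≤ d i := by
    intro i
    have h1 : Tendsto (fun m => ∑ k : S, jacobian f (kleene f (φ m)) i k *
        ((lfp f k - kleene f (φ m) k) / s (φ m))) atTop
        (𝓝 (∑ k : S, jacobian f (lfp f) i k * d k)) := by
      refine tendsto_finsetSum _ fun k _ => ?_
      exact (((continuous_jacobian f i k).tendsto _).comp (hlim.comp hφ.tendsto_atTop)).mul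
        (tendsto_pi_nhds.mp hdlim k)
    refine le_of_tendsto_of_tendsto' h1 (tendsto_pi_nhds.mp hdlim i) fun m => ?_
    have h2 := hstep (φ m) i
    have h3 := kleene_le_succ hp (φ m) i
    have h4 : ∑ k : S, jacobian f (kleene f (φ m)) i k * (lfp f k - kleene f (φ m) k) ≤
        ∑ k : S, (jacobian f (kleene f (φ m)) i k + jacobian f (lfp f) i k) / 2 *
          (lfp f k - kleene f (φ m) k) := by
      refine Finset.sum_le_sum fun k _ => mul_le_mul_of_nonneg_right ?_ (hdnn _ k)
      linarith [hp.jac_mono _ _ (kleene_nonneg hp (φ m)) (kleene_le hp hμ (φ m)) i k]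
    simp only [Function.comp_apply, mul_div_assoc', ← Finset.sum_div]
    exact div_le_div_of_nonneg_right (by linarith) (hs _).le
  -- The zero set of `d` is closed under positive entries; if non-empty it would be all of `S`, but
  -- the entries of `d` sum to one.
  refine ⟨d, fun i => (hd.1 i).lt_of_ne' fun hi => ?_, hle⟩
  have hall := hirr {i | d i = 0} ⟨i, hi⟩ fun i hi k hik => by
    have n : ∀ k ∈ (Finset.univ : Finset S), 0 ≤ jacobian f (lfp f) i k * d k := fun k _ =>
      mul_nonneg (hp.jac_nonneg _ hμ.1 i k) (hd.1 k)
    have h1 := hle i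
    rw [show d i = 0 from hi] at h1
    have h2 := (Finset.sum_eq_zero_iff_of_nonneg n).mp
      (le_antisymm h1 (Finset.sum_nonneg n)) k (Finset.mem_univ k)
    exact (mul_eq_zero.mp h2).resolve_left hik.ne'
  have h1 := hd.2
  rw [Finset.sum_eq_zero fun k _ => hall k] at h1
  exact zero_ne_one h1

theorem HasJacobianExpansion.isRegularBlock [DecidableEq σ]
    (h : HasJacobianExpansion f L Q) (hm : IsMonotone f) (hf : IsFeasible f) (hc : IsClean f)
    (hS : IsSCC f S) :
    IsRegularBlock (Matrix.of fun i k : S => jacobian f (lfp f) i k)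
      (fun i k l : S => Q i k l) (fun i : S => lfp f i) where
  pos i := lfp_pos (h.isQuadraticPair hm) hf hc i
  jac_nonneg i k := by
    have hp := h.isQuadraticPair hm
    exact hp.jac_nonneg _ (isLeast_lfp hp hf).1.1 i k
  hess_nonneg i k l := h.quad_nonneg i k l
  jac_pos i k l hikl := by
    have hpos := lfp_pos (h.isQuadraticPair hm) hf hc
    rw [Matrix.of_apply, h.jac_eq]
    exact add_pos_of_nonneg_of_pos (h.lin_nonneg i k) (Finset.sum_pos'
      (fun l _ => mul_nonneg (h.quad_nonneg i k l) (hpos l).le)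
      ⟨l, Finset.mem_univ _, mul_pos hikl (hpos l)⟩)
  dichotomy := by
    by_cases hQ : ∃ i k l : S, 0 < Q i k l
    · exact Or.inr ⟨hS.isIrred hm (lfp_pos (h.isQuadraticPair hm) hf hc),
        h.exists_cone_vector hm hf hc hS hQ, hQ⟩
    · push Not at hQ
      exact Or.inl (h.isContractive_of_linear hm hf hc hS fun i k l =>
        le_antisymm (hQ i k l) (h.quad_nonneg i k l))

end Component

/-! ### Depth and height in the DAG of SCCs -/

section Depth

variable {σ : Type} [Fintype σ] {f : PolySystem σ} {S T : Finset σ}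

/-- The number of variables on which the variables of `S` depend. -/
noncomputable def reachCard (f : PolySystem σ) (S : Finset σ) : ℕ :=
  open Classical in (Finset.univ.filter fun k => ∃ i ∈ S, Depends f i k).card

theorem reachCard_le (f : PolySystem σ) (S : Finset σ) : reachCard f S ≤ Fintype.card σ :=
  Finset.card_le_univ _

/-- A strictly increasing bounded rank along edges: paths have bounded length, so that the suprema
in `depth` and `height` are over bounded sets and do not default to zero. -/
theorem reachCard_lt_of_edge (h : (S, T) ∈ sccEdge f) : reachCard f S < reachCard f T := by
  classical
  obtain ⟨hS, hT, hne, i, hi, k, hk, hik⟩ := h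
  have hik' : Depends f i k := Relation.ReflTransGen.single hik
  apply Finset.card_lt_card
  rw [Finset.ssubset_iff_of_subset]
  · refine ⟨i, ?_, ?_⟩
    · simp only [Finset.mem_filter, Finset.mem_univ, true_and]
      exact ⟨i, hi, Relation.ReflTransGen.refl⟩
    · simp only [Finset.mem_filter, Finset.mem_univ, true_and]
      rintro ⟨s, hs, hsi⟩
      have hiS : i ∈ S := hS.mem_of_depends hk hk ((hS.1.2 k hk s hs).trans hsi) hik'
      exact hne ((eq_sccOf_of_isSCC f hS hiS).trans (eq_sccOf_of_isSCC f hT hi).symm)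
  · intro j hj
    simp only [Finset.mem_filter, Finset.mem_univ, true_and] at hj ⊢
    obtain ⟨s, hs, hsj⟩ := hj
    exact ⟨i, hi, hik'.trans ((hS.1.2 k hk s hs).trans hsj)⟩

theorem relSeries_length_le (p : RelSeries (sccEdge f)) : p.length ≤ Fintype.card σ := by
  have key : reachCard f p.head + p.length ≤ Fintype.card σ := by
    induction p using RelSeries.inductionOn with
    | singleton x => simpa using reachCard_le f x
    | cons p x hx ih =>
      have := reachCard_lt_of_edge hx
      simp only [RelSeries.head_cons, RelSeries.cons_length]
      omega
  omega

theorem exists_path_to_top (hS : IsSCC f S) :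
    ∃ p : RelSeries (sccEdge f), p.head = S ∧ IsTopSCC f p.last := by
  induction hn : Fintype.card σ - reachCard f S using Nat.strong_induction_on generalizing S with
  | _ n ih =>
    by_cases hT : ∃ T, (S, T) ∈ sccEdge f
    · obtain ⟨T, hT⟩ := hT
      have h1 := reachCard_lt_of_edge hT
      have h2 := reachCard_le f T
      obtain ⟨p, hp, htop⟩ := ih (Fintype.card σ - reachCard f T) (by omega) hT.2.1 rfl
      subst hp
      exact ⟨p.cons S hT, p.head_cons S hT, by rwa [RelSeries.last_cons]⟩
    · push Not at hT
      exact ⟨RelSeries.singleton _ S, rfl, hS, hT⟩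

theorem exists_path_length_eq_depth (hS : IsSCC f S) :
    ∃ p : RelSeries (sccEdge f), p.head = S ∧ IsTopSCC f p.last ∧ p.length = depth f S := by
  obtain ⟨p, hp, htop⟩ := exists_path_to_top hS
  exact Nat.sSup_mem (s := {l : ℕ | ∃ p : RelSeries (sccEdge f),
    p.head = S ∧ IsTopSCC f p.last ∧ p.length = l}) ⟨p.length, p, hp, htop, rfl⟩
    ⟨Fintype.card σ, by rintro _ ⟨p, -, -, rfl⟩; exact relSeries_length_le p⟩

theorem depth_lt_of_edge (h : (S, T) ∈ sccEdge f) : depth f T < depth f S := by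
  obtain ⟨p, hp, htop, hl⟩ := exists_path_length_eq_depth h.2.1
  subst hp
  rw [← hl, ← Nat.succ_le_iff]
  refine le_csSup ⟨Fintype.card σ, ?_⟩
    ⟨p.cons S h, p.head_cons S h, by rwa [RelSeries.last_cons], p.cons_length S h⟩
  rintro _ ⟨p, -, -, rfl⟩
  exact relSeries_length_le p

theorem depth_le_height (hS : IsSCC f S) : depth f S ≤ height f := by
  obtain ⟨p, hp, -, hl⟩ := exists_path_length_eq_depth hS
  refine le_csSup ⟨Fintype.card σ, ?_⟩ ⟨p, hp ▸ hS, hl⟩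
  rintro _ ⟨p, -, rfl⟩
  exact relSeries_length_le p

theorem depth_lt_of_dependsDirectly (hS : IsSCC f S) {i k : σ} (hi : i ∈ S) (hk : k ∉ S)
    (hik : DependsDirectly f i k) : depth f S < depth f (sccOf f k) := by
  apply depth_lt_of_edge
  exact ⟨isSCC_sccOf f k, hS, fun (h : sccOf f k = S) => hk (h ▸ mem_sccOf_self f k), i, hi, k,
    mem_sccOf_self f k, hik⟩

end Depth

/-! ### Error propagation through the passes -/

section Loop

variable {σ : Type} [Fintype σ] [DecidableEq σ] {f : PolySystem σ} {L : σ → σ → ℝ}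
  {Q : σ → σ → σ → ℝ}

omit [Fintype σ] in
theorem sccIterate_eq (f : PolySystem σ) (S : Finset σ) (ν : σ → ℝ) (k : ℕ) :
    sccIterate f S ν k =
      (newtonStep (value (subsystem f S ν)) (jacobian (subsystem f S ν)))^[k] 0 := rfl

theorem dnmPass_of_depth_eq (f : PolySystem σ) (j : ℕ) (ν : σ → ℝ) (i : σ) :
    dnmPass f j (depth f (sccOf f i)) ν i =
      sccIterate f (sccOf f i) ν (j * 2 ^ depth f (sccOf f i)) ⟨i, mem_sccOf_self f i⟩ :=
  if_pos ⟨isSCC_sccOf f i, rfl⟩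

theorem dnmPass_of_depth_ne (f : PolySystem σ) (j : ℕ) (ν : σ → ℝ) {t : ℕ} {i : σ}
    (h : depth f (sccOf f i) ≠ t) : dnmPass f j t ν i = ν i :=
  if_neg fun hi => h hi.2

theorem HasJacobianExpansion.dnmLoop_mem_Icc (h : HasJacobianExpansion f L Q)
    (hm : IsMonotone f) (hf : IsFeasible f) (hc : IsClean f) (j m : ℕ) :
    0 ≤ dnmLoop f j m ∧ dnmLoop f j m ≤ lfp f := by
  have hμ := (isLeast_lfp (h.isQuadraticPair hm) hf).1
  induction m with
  | zero => exact ⟨le_rfl, hμ.1⟩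
  | succ m ih =>
    have key : ∀ i, 0 ≤ dnmLoop f j (m + 1) i ∧ dnmLoop f j (m + 1) i ≤ lfp f i := by
      intro i
      rw [dnmLoop]
      by_cases hi : depth f (sccOf f i) = height f - m
      · rw [← hi, dnmPass_of_depth_eq]
        have hb := h.isRegularBlock hm hf hc (isSCC_sccOf f i)
        have hlb := h.isLowerBlock_subsystem (S := sccOf f i) hm hμ.2 ih.1 ih.2
        obtain ⟨h1, h2, -⟩ := hlb.newton_iterate hb (j * 2 ^ depth f (sccOf f i))
        exact ⟨h1 _, h2 _⟩
      · rw [dnmPass_of_depth_ne f j _ hi]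
        exact ⟨ih.1 i, ih.2 i⟩
    exact ⟨fun i => (key i).1, fun i => (key i).2⟩

theorem HasJacobianExpansion.dnmWellDefined (h : HasJacobianExpansion f L Q)
    (hm : IsMonotone f) (hf : IsFeasible f) (hc : IsClean f) (j : ℕ) : DNMWellDefined f j := by
  intro t _ S hS k _
  have hμ := (isLeast_lfp (h.isQuadraticPair hm) hf).1
  obtain ⟨h0, h1⟩ := h.dnmLoop_mem_Icc hm hf hc j (height f - t)
  exact (h.isLowerBlock_subsystem (S := S) hm hμ.2 h0 h1).isUnit_newton_iterate
    (h.isRegularBlock hm hf hc hS.1) k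

/-- After the passes at the depths `> height f - m`, the error at depth `t` is of the order of
`2 ^ (-j * 2 ^ t)`. -/
theorem HasJacobianExpansion.exists_dnmLoop_error_const (h : HasJacobianExpansion f L Q)
    (hm : IsMonotone f) (hf : IsFeasible f) (hc : IsClean f) (m : ℕ) (hmh : m ≤ height f + 1) :
    ∃ C : ℝ, 0 ≤ C ∧ ∀ j i, height f < depth f (sccOf f i) + m →
      lfp f i - dnmLoop f j m i ≤ C * (1 / 2) ^ (j * 2 ^ depth f (sccOf f i)) := by
  induction m with
  | zero =>
    refine ⟨0, le_rfl, fun j i hi => ?_⟩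
    have := depth_le_height (isSCC_sccOf f i)
    omega
  | succ m ih =>
    obtain ⟨C, hC, ih⟩ := ih (by omega)
    have hp := h.isQuadraticPair hm
    have hμ := (isLeast_lfp hp hf).1
    have hJ0 := hp.jac_nonneg _ hμ.1
    have hpos := lfp_pos hp hf hc
    -- `B` bounds every row sum of the Jacobian, so an outer error `C * ε ^ 2` perturbs each
    -- equation by at most `B * C * ε ^ 2`.
    let B : ℝ := ∑ i, ∑ k, jacobian f (lfp f) i k
    choose C' hC'0 hC' using fun i =>
      (h.isRegularBlock hm hf hc (isSCC_sccOf f i)).exists_error_const (B * C)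
    have hC's : 0 ≤ ∑ i, C' i := Finset.sum_nonneg fun i _ => hC'0 i
    refine ⟨C + ∑ i, C' i, add_nonneg hC hC's, fun j i hi => ?_⟩
    obtain ⟨hν0, hνμ⟩ := h.dnmLoop_mem_Icc hm hf hc j m
    set ν := dnmLoop f j m with hν
    rw [dnmLoop, ← hν]
    -- The bound on `m` gives `m ≤ height f`, so the subtraction is not truncated and this pass
    -- treats exactly the depth that the claim newly covers.
    by_cases hit : depth f (sccOf f i) = height f - m
    · rw [← hit, dnmPass_of_depth_eq]
      set S := sccOf f i with hS
      set t := depth f S with ht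
      set ε : ℝ := (1 / 2) ^ (j * 2 ^ t) with hε
      have hε0 : 0 < ε := by positivity
      have hε1 : ε ≤ 1 := pow_le_one₀ (by norm_num) (by norm_num)
      -- Only strictly deeper SCCs contribute. Their error exponent is at least `j * 2 ^ (t + 1)`,
      -- twice that of `ε`, which gives the square.
      have hδ : ∀ v : S, ∑ k ∈ Sᶜ, jacobian f (lfp f) v k * (lfp f k - ν k) ≤
          B * C * ε ^ 2 := by
        intro v
        have h1 : ∀ k ∈ Sᶜ, jacobian f (lfp f) v k * (lfp f k - ν k) ≤
            jacobian f (lfp f) v k * (C * ε ^ 2) := by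
          intro k hk
          by_cases hvk : DependsDirectly f v k
          · refine mul_le_mul_of_nonneg_left ?_ (hJ0 v k)
            have h2 : t < depth f (sccOf f k) := depth_lt_of_dependsDirectly (isSCC_sccOf f i) v.2
              (Finset.mem_compl.mp hk) hvk
            refine (ih j k (by omega)).trans (mul_le_mul_of_nonneg_left ?_ hC)
            rw [hε, ← pow_mul]
            refine pow_le_pow_of_le_one (by norm_num) (by norm_num) ?_
            rw [mul_assoc, ← pow_succ]
            exact Nat.mul_le_mul_left j (Nat.pow_le_pow_right (by norm_num) h2)
          · rw [dependsDirectly_iff hm hpos] at hvk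
            rw [le_antisymm (not_lt.mp hvk) (hJ0 v k), zero_mul, zero_mul]
        have h2 : ∑ k ∈ Sᶜ, jacobian f (lfp f) v k ≤ B :=
          (Finset.sum_le_sum_of_subset_of_nonneg (Finset.subset_univ _)
            fun k _ _ => hJ0 v k).trans
          (Finset.single_le_sum (f := fun i => ∑ k, jacobian f (lfp f) i k)
            (fun i _ => Finset.sum_nonneg fun k _ => hJ0 i k) (Finset.mem_univ (v : σ)))
        calc _ ≤ ∑ k ∈ Sᶜ, jacobian f (lfp f) v k * (C * ε ^ 2) := Finset.sum_le_sum h1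
          _ = (∑ k ∈ Sᶜ, jacobian f (lfp f) v k) * (C * ε ^ 2) := by rw [Finset.sum_mul]
          _ ≤ B * (C * ε ^ 2) := mul_le_mul_of_nonneg_right h2 (by positivity)
          _ = _ := by ring
      have h3 := hC' i ε hε0 hε1 _ _
        (h.isLowerBlock_subsystem (S := S) hm hμ.2 hν0 hνμ)
        (fun x hx hxb v => h.sub_value_subsystem_le hm hμ.2 hν0 hνμ v (hδ v) x hx hxb)
        (j * 2 ^ t) (by rw [hε, one_div_pow]) ⟨i, mem_sccOf_self f i⟩
      rw [sccIterate_eq]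
      refine h3.trans (mul_le_mul_of_nonneg_right ?_ hε0.le)
      have := Finset.single_le_sum (f := C') (fun i _ => hC'0 i) (Finset.mem_univ i)
      linarith
    · rw [dnmPass_of_depth_ne f j _ hit]
      refine (ih j i (by omega)).trans (mul_le_mul_of_nonneg_right ?_ (by positivity))
      linarith

theorem HasJacobianExpansion.exists_hasValidBits (h : HasJacobianExpansion f L Q)
    (hm : IsMonotone f) (hf : IsFeasible f) (hc : IsClean f) :
    ∃ kf : ℕ, ∀ i : ℕ, HasValidBits i (lfp f) (dnm f (kf + i)) := by
  have hpos := lfp_pos (h.isQuadraticPair hm) hf hc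
  obtain ⟨C, hC, herr⟩ := h.exists_dnmLoop_error_const hm hf hc _ le_rfl
  -- `k` absorbs the constant relative to the size of the least fixed point. Depth zero is the worst
  -- case, with one bit per unit of the parameter.
  obtain ⟨k, hk⟩ := pow_unbounded_of_one_lt (∑ s, C / lfp f s) (one_lt_two (α := ℝ))
  refine ⟨k, fun i s => ?_⟩
  have h1 := herr (k + i) s (by omega)
  have h2 : dnm f (k + i) s ≤ lfp f s := (h.dnmLoop_mem_Icc hm hf hc (k + i) _).2 s
  have h3 : C / lfp f s ≤ 2 ^ k :=
    (Finset.single_le_sum (f := fun s => C / lfp f s)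
      (fun s _ => div_nonneg hC (hpos s).le) (Finset.mem_univ s)).trans hk.le
  rw [div_le_iff₀ (hpos s)] at h3
  rw [abs_of_nonneg (sub_nonneg.mpr h2), abs_of_pos (hpos s), div_le_iff₀ (hpos s)]
  have h4 : (1 / 2 : ℝ) ^ ((k + i) * 2 ^ depth f (sccOf f s)) ≤ (1 / 2) ^ (k + i) :=
    pow_le_pow_of_le_one (by norm_num) (by norm_num)
      (Nat.le_mul_of_pos_right _ (by positivity))
  calc lfp f s - dnm f (k + i) s ≤ C * (1 / 2) ^ (k + i) :=
        h1.trans (mul_le_mul_of_nonneg_left h4 hC)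
    _ ≤ 2 ^ k * lfp f s * (1 / 2) ^ (k + i) := mul_le_mul_of_nonneg_right h3 (by positivity)
    _ = (2 * (1 / 2)) ^ k * (1 / 2) ^ i * lfp f s := by rw [mul_pow, pow_add]; ring
    _ = (2 : ℝ) ^ (-(i : ℤ)) * lfp f s := by simp

end Loop
end MSP

theorem theorem5p3 (n : ℕ) (f : MSP.PolySystem (Fin n))
    (hmono : MSP.IsMonotone f) (hfeas : MSP.IsFeasible f) (hclean : MSP.IsClean f)
    (hquad : MSP.IsQuadratic f) :
    IsLeast (MSP.nonnegFixedPoints f) (MSP.lfp f) ∧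
    (∀ j : ℕ, MSP.DNMWellDefined f j) ∧
    ∃ kf : ℕ, ∀ i : ℕ, MSP.HasValidBits i (MSP.lfp f) (MSP.dnm f (kf + i)) := by
  obtain ⟨L, Q, h⟩ := MSP.exists_jacobianExpansion hmono hquad
  exact ⟨MSP.isLeast_lfp (h.isQuadraticPair hmono) hfeas,
    fun j => h.dnmWellDefined hmono hfeas hclean j,
    h.exists_hasValidBits hmono hfeas hclean⟩
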